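/- Theorem 4 (unattainability of the Heisenberg limit). Let $\mathcal H_E,\mathcal H_P$ be finite-dimensional Hilbert spaces (environment and probe), $d_E=\dim\mathcal H_E\ge 1$. Let $G$ on $\mathcal H_P$, $H_E$ on $\mathcal H_E$ and $H_{EP}$ on $\mathcal H_E\otimes\mathcal H_P$ be Hermitian and let $L_1,\dots,L_r$ be operators on $\mathcal H_E\otimes\mathcal H_P$. For every finite-dimensional auxiliary space $\mathcal H_A$ and every real parameter $\omega$, the state $\rho$ on $\mathcal H_E\otimes\mathcal H_P\otimes\mathcal H_A$ evolves freely by $$\frac{d\rho}{dt}=-\mathrm i\big[H_{EP}+\omega(\mathbb 1_E\otimes G+H_E\otimes\mathbb 1_P),\rho\big]+\sum_{k=1}^r\Big(L_k\rho L_k^\dagger-\tfrac12\{L_k^\dagger L_k,\rho\}\Big),$$ where all operators are extended by $\mathbb 1_A$. A strategy consists of a finite-dimensional $\mathcal H_A$, an initial density matrix on $\mathcal H_E\otimes\mathcal H_P\otimes\mathcal H_A$, and finitely many stages, each of them a free evolution for a time $t_i\ge0$ followed by an instantaneous completely positive trace-preserving map on $\mathcal H_P\otimes\mathcal H_A$ (the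 environment is left untouched); none of these data depends on $\omega$. Its total time is $T=\sum_i t_i$, and its output $\rho_{PA}(\omega)$ is the final state with the environment traced out. Its quantum Fisher information is $\mathcal F=2\sum_{\gamma_i+\gamma_j>0}|\langle\gamma_i|\partial_\omega\rho_{PA}|\gamma_j\rangle|^2/(\gamma_i+\gamma_j)$, where $\gamma_i,|\gamma_i\rangle$ are the eigenvalues and orthonormal eigenvectors of $\rho_{PA}(\omega)$. Let $\mathcal S_{EP}$ be the complex linear span of $\mathbb 1_{EP}$, $L_k$, $L_k^\dagger$ and $L_k^\dagger L_j$ ($1\le k,j\le r$), and suppose that $\mathbb 1_E\otimes G+H_E\otimes\mathbb 1_P\in\mathcal S_{EP}$. Then: 1. $\mathcal F=O(T)$, so the standard quantum limit is the best achievable scaling: there is a constant $C$, depending only on $G,H_E,H_{EP},L_1,\dots,L_r$, such that for every strategy and every $\omega\in\mathbb R$ the output $\rho_{PA}$ is a density matrix, is differentiable in the parameter at $\omega$, and satisfies $\mathcal F\le C\,T$. 2. For every orthonormal basis $(|\phi_i\rangle)$ of $\mathcal H_E$, $G$ lies in the complex linear span $\mathcal S$ of the operators $\mathbb 1_P$,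 $\langle\phi_i|H_{EP}|\phi_m\rangle$, $\langle\phi_i|L_k|\phi_m\rangle$, $\langle\phi_i|L_k^\dagger|\phi_m\rangle$ and $\langle\phi_i|L_k^\dagger|\phi_m\rangle\langle\phi_n|L_j|\phi_l\rangle$ on $\mathcal H_P$ (all $k,j$ and all $i,m,n,l$). -/

import Mathlib

open scoped Kronecker Matrix ComplexOrder

noncomputable section

namespace HMM

/-- `n × n` complex matrices, i.e. operators on a Hilbert space with orthonormal basis `n`. -/
abbrev Op (n : Type) := Matrix n n ℂ

/-- Index set of the product basis of environment, probe and auxiliary system. -/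
abbrev EPA (dE dP dA : ℕ) := Fin dE × (Fin dP × Fin dA)

/-- A density matrix: positive semidefinite with unit trace. -/
def IsDensity {n : Type} [Fintype n] (ρ : Op n) : Prop :=
  ρ.PosSemidef ∧ ρ.trace = 1

/-- The ampliation `id_k ⊗ Φ` of a superoperator `Φ`, acting blockwise. -/
def ampliate {k n : Type} (Φ : Op n →ₗ[ℂ] Op n) (ρ : Op (k × n)) : Op (k × n) :=
  Matrix.of fun x y => Φ (Matrix.of fun a b => ρ (x.1, a) (y.1, b)) x.2 y.2

/-- Completely positive trace-preserving maps: every ampliation `id_k ⊗ Φ` preserves positive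
semidefiniteness, and `Φ` preserves the trace. -/
structure IsCPTP {n : Type} [Fintype n] (Φ : Op n →ₗ[ℂ] Op n) : Prop where
  completely_positive : ∀ (k : ℕ) (ρ : Op (Fin k × n)), ρ.PosSemidef → (ampliate Φ ρ).PosSemidef
  trace_preserving : ∀ ρ : Op n, (Φ ρ).trace = ρ.trace

/-- The partial trace over the first tensor factor. -/
def traceFirst {k n : Type} [Fintype k] (ρ : Op (k × n)) : Op n :=
  Matrix.of fun a b => ∑ e, ρ (e, a) (e, b)

/-- The Lindblad generator
`ρ ↦ -i[H, ρ] + ∑ₖ (Lₖ ρ Lₖ† - ½ {Lₖ† Lₖ, ρ})`. -/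
def lindbladian {n : Type} [Fintype n] {r : ℕ} (H : Op n) (L : Fin r → Op n) :
    Op n →ₗ[ℂ] Op n where
  toFun ρ := -Complex.I • (H * ρ - ρ * H) +
    ∑ k, (L k * ρ * (L k)ᴴ - (1 / 2 : ℂ) • ((L k)ᴴ * L k * ρ + ρ * ((L k)ᴴ * L k)))
  map_add' ρ σ := by
    have h : ∀ k, L k * (ρ + σ) * (L k)ᴴ -
        (1 / 2 : ℂ) • ((L k)ᴴ * L k * (ρ + σ) + (ρ + σ) * ((L k)ᴴ * L k)) =
        (L k * ρ * (L k)ᴴ - (1 / 2 : ℂ) • ((L k)ᴴ * L k * ρ + ρ * ((L k)ᴴ * L k))) +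
        (L k * σ * (L k)ᴴ - (1 / 2 : ℂ) • ((L k)ᴴ * L k * σ + σ * ((L k)ᴴ * L k))) := by
      intro k
      simp only [mul_add, add_mul, smul_add]
      abel
    simp only [h, Finset.sum_add_distrib]
    simp only [mul_add, add_mul, smul_add, smul_sub]
    abel
  map_smul' c ρ := by
    simp only [RingHom.id_apply, smul_add, Finset.smul_sum, mul_smul_comm, smul_mul_assoc,
      smul_sub, smul_comm c]

section Evolution

/-- The superoperator `exp (t • 𝓛)`, computed as the exponential of the matrix of `t • 𝓛` in the
basis of matrix units. -/
def semigroup {n : Type} [Fintype n] [DecidableEq n] (𝓛 : Op n →ₗ[ℂ] Op n) (t : ℝ) :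
    Op n →ₗ[ℂ] Op n :=
  Matrix.toLin (Matrix.stdBasis ℂ n n) (Matrix.stdBasis ℂ n n)
    (NormedSpace.exp
      ((t : ℂ) • LinearMap.toMatrix (Matrix.stdBasis ℂ n n) (Matrix.stdBasis ℂ n n) 𝓛))

theorem semigroup_zero {n : Type} [Fintype n] [DecidableEq n] (𝓛 : Op n →ₗ[ℂ] Op n) (ρ : Op n) :
    semigroup 𝓛 0 ρ = ρ := by
  simp [semigroup]

open scoped Matrix.Norms.Operator in
theorem matrix_exp_hasDerivAt {m : Type} [Fintype m] [DecidableEq m] (A : Op m) (t : ℝ)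
    (i j : m) :
    HasDerivAt (fun s : ℝ => NormedSpace.exp ((s : ℂ) • A) i j)
      ((A * NormedSpace.exp ((t : ℂ) • A)) i j) t := by
  have h := hasDerivAt_exp_smul_const' (𝕂 := ℝ) A t
  exact hasDerivAt_pi.1 (hasDerivAt_pi.1 h i) j

/-- `t ↦ exp (t • 𝓛) ρ` solves the equation `dρ/dt = 𝓛 ρ`. -/
theorem semigroup_hasDerivAt {n : Type} [Fintype n] [DecidableEq n] (𝓛 : Op n →ₗ[ℂ] Op n)
    (ρ : Op n) (t : ℝ) (i j : n) :
    HasDerivAt (fun s : ℝ => semigroup 𝓛 s ρ i j) (𝓛 (semigroup 𝓛 t ρ) i j) t := by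
  set b := Matrix.stdBasis ℂ n n
  set A := LinearMap.toMatrix b b 𝓛 with hA
  have entry : ∀ (B : Matrix (n × n) (n × n) ℂ),
      Matrix.toLin b b B ρ i j = ∑ q, B (i, j) q * b.repr ρ q := by
    intro B
    have h1 : b.repr (Matrix.toLin b b B ρ) (i, j) = ∑ q, B (i, j) q * b.repr ρ q := by
      rw [Matrix.toLin_apply, Module.Basis.repr_sum_self]
      rfl
    exact h1
  have h2 : 𝓛 (semigroup 𝓛 t ρ) =
      Matrix.toLin b b (A * NormedSpace.exp ((t : ℂ) • A)) ρ := by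
    rw [Matrix.toLin_mul b b b, hA, Matrix.toLin_toMatrix]
    rfl
  rw [h2, entry]
  have h3 : (fun s : ℝ => semigroup 𝓛 s ρ i j) =
      fun s : ℝ => ∑ q, NormedSpace.exp ((s : ℂ) • A) (i, j) q * b.repr ρ q :=
    funext fun s => entry _
  rw [h3]
  exact HasDerivAt.fun_sum fun q _ => (matrix_exp_hasDerivAt A t (i, j) q).mul_const _

end Evolution

/-- The hidden Markov model: probe signal Hamiltonian `G`, environment signal Hamiltonian `HE`,
coupling `HEP`, and jump operators `L k` on environment and probe.
The case of a trivial `G` is not excluded. -/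
structure Model (dE dP r : ℕ) where
  G : Op (Fin dP)
  HE : Op (Fin dE)
  HEP : Op (Fin dE × Fin dP)
  L : Fin r → Op (Fin dE × Fin dP)
  G_herm : G.IsHermitian
  HE_herm : HE.IsHermitian
  HEP_herm : HEP.IsHermitian

/-- `X ↦ X ⊗ 1_A`, from operators on environment and probe to operators on the full space. -/
def lift {dE dP : ℕ} (dA : ℕ) (X : Op (Fin dE × Fin dP)) : Op (EPA dE dP dA) :=
  (X ⊗ₖ (1 : Op (Fin dA))).submatrix
    (Equiv.prodAssoc (Fin dE) (Fin dP) (Fin dA)).symm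
    (Equiv.prodAssoc (Fin dE) (Fin dP) (Fin dA)).symm

namespace Model

variable {dE dP r : ℕ} (M : Model dE dP r)

/-- The total signal Hamiltonian `1_E ⊗ G + H_E ⊗ 1_P`. -/
def signal : Op (Fin dE × Fin dP) :=
  (1 : Op (Fin dE)) ⊗ₖ M.G + M.HE ⊗ₖ (1 : Op (Fin dP))

/-- The generator of the master equation on environment, probe and auxiliary system at
parameter value `ω`. -/
def generator (dA : ℕ) (ω : ℝ) : Op (EPA dE dP dA) →ₗ[ℂ] Op (EPA dE dP dA) :=
  lindbladian (lift dA (M.HEP + (ω : ℂ) • M.signal)) (fun k => lift dA (M.L k))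

/-- The Lindblad span of environment and probe, spanned by
`1`, `Lₖ`, `Lₖ†` and `Lₖ† Lⱼ`. -/
def lindbladSpan : Submodule ℂ (Op (Fin dE × Fin dP)) :=
  Submodule.span ℂ ({1} ∪ (Set.range fun k => M.L k) ∪ (Set.range fun k => (M.L k)ᴴ) ∪
    (Set.range fun q : Fin r × Fin r => (M.L q.1)ᴴ * M.L q.2))

end Model

/-- The operator `⟨u| A |v⟩` on the probe, for environment vectors `u`, `v`. -/
def block {dE dP : ℕ} (u v : EuclideanSpace ℂ (Fin dE)) (A : Op (Fin dE × Fin dP)) :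
    Op (Fin dP) :=
  Matrix.of fun p q => ∑ a, ∑ b, star (u a) * A (a, p) (b, q) * v b

/-- The extended span on the probe, spanned by `1`, `⟨φᵢ|H_EP|φₘ⟩`, `⟨φᵢ|Lₖ|φₘ⟩`, `⟨φᵢ|Lₖ†|φₘ⟩`
and `⟨φᵢ|Lₖ†|φₘ⟩⟨φₙ|Lⱼ|φₗ⟩`, for an orthonormal basis `φ` of the environment. -/
def Model.extendedSpan {dE dP r : ℕ} (M : Model dE dP r)
    (φ : OrthonormalBasis (Fin dE) ℂ (EuclideanSpace ℂ (Fin dE))) :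
    Submodule ℂ (Op (Fin dP)) :=
  Submodule.span ℂ
    ({X | X = 1 ∨
      (∃ i m, X = block (φ i) (φ m) M.HEP) ∨
      (∃ i m k, X = block (φ i) (φ m) (M.L k)) ∨
      (∃ i m k, X = block (φ i) (φ m) (M.L k)ᴴ) ∨
      (∃ i m n l k j, X = block (φ i) (φ m) (M.L k)ᴴ * block (φ n) (φ l) (M.L j))})

/-- One stage of a sensing strategy: free evolution for time `duration`, followed by an
instantaneous control operation on probe and auxiliary system. -/
structure Stage (dP dA : ℕ) where
  duration : ℝ
  control : Op (Fin dP × Fin dA) →ₗ[ℂ] Op (Fin dP × Fin dA)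
  duration_nonneg : 0 ≤ duration
  control_cptp : IsCPTP control

/-- A sensing strategy with auxiliary dimension `dA`: an initial state of environment, probe and
auxiliary system, and finitely many stages; none of these depends on the parameter `ω`.
Intermediate measurements and feed-forward are covered, as outcomes can be recorded in the
auxiliary system. -/
structure Strategy (dE dP dA : ℕ) where
  init : Op (EPA dE dP dA)
  init_density : IsDensity init
  stages : List (Stage dP dA)

namespace Strategy

variable {dE dP dA r : ℕ}

/-- The total sensing time `T` of a strategy. -/
def totalTime (S : Strategy dE dP dA) : ℝ := (S.stages.map Stage.duration).sum

/-- The final state of environment, probe and auxiliary system at parameter value `ω`. -/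
def finalState (S : Strategy dE dP dA) (M : Model dE dP r) (ω : ℝ) : Op (EPA dE dP dA) :=
  S.stages.foldl
    (fun ρ s => ampliate s.control (semigroup (M.generator dA ω) s.duration ρ)) S.init

/-- The final reduced state of probe and auxiliary system. -/
def output (S : Strategy dE dP dA) (M : Model dE dP r) (ω : ℝ) : Op (Fin dP × Fin dA) :=
  traceFirst (S.finalState M ω)

end Strategy

open Classical in
/-- The quantum Fisher information at `ω` of a differentiable family of density matrices,
`2 ∑ |⟨γᵢ|∂ρ|γⱼ⟩|² / (γᵢ + γⱼ)` over the pairs of eigenvalues with `γᵢ + γⱼ > 0`. -/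
def qfi {n : Type} [Fintype n] (ρ : ℝ → Op n) (ω : ℝ) : ℝ :=
  if h : (ρ ω).IsHermitian then
    2 * ∑ i, ∑ j, if 0 < h.eigenvalues i + h.eigenvalues j then
      ‖star (h.eigenvectorBasis i : n → ℂ) ⬝ᵥ
        ((Matrix.of fun a b => deriv (fun w => ρ w a b) ω) *ᵥ
          (h.eigenvectorBasis j : n → ℂ))‖ ^ 2 / (h.eigenvalues i + h.eigenvalues j)
    else 0
  else 0

end HMM

end

open scoped Kronecker Matrix ComplexOrder

noncomputable section

/-! The Fisher information is the supremum over Hermitian `A` of `2 tr(A ∂ρ) - tr(A² ρ)`. In this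
form (`FisherBound`) an upper bound can be followed through a strategy on the full space of
environment, probe and auxiliary system; memory in the environment then needs no separate treatment.

A control map cannot raise the bound: test with the dual observable and use the Kadison-Schwarz
inequality (`IsTwoPositive.trace_sq_le`). The same holds for the final partial trace, tested with `1
⊗ A`. Free evolution for time `t` raises it by at most `K t`. Let `B(s)` be the observable `A`
evolved backwards from time `t` to `s`. Then `tr(B(s)² ρ(s))` grows at the rate `∑ₖ tr(ρ [Lₖ,B]†
[Lₖ,B])`, the carré du champ (`trace_lindbladian_carre_du_champ`), while the signal `S` contributes
to `2 tr(A ∂ρ)` at the rate `2 Re (i tr(ρ [S,B]))`. If the first rate plus `K` dominates the second,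
integration gives the bound (`re_trace_mul_response_le`), and the second moments at the ends cancel
between consecutive steps.

The hypothesis on the signal supplies this domination. For `S` in the Lindblad span, `[S,B]` is a
combination of terms `X† [Lₖ,B]` and `[Lₖ,B]† X` with fixed `X`, so Cauchy-Schwarz applies
(`dissipativelyBounded_of_mem_lindbladSpan`). The constant depends neither on `ω` nor on the
auxiliary dimension, because `X†X ≤ c` survives tensoring with the identity. The symmetric
logarithmic derivative as test observable converts the variational bound into one on `qfi`.

The second claim is algebraic: a diagonal environment block of the signal is `G` plus a multiple of
`1`, and blocks of `Lₖ† Lⱼ` expand by the resolution of the identity. -/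

namespace HMM

/-! ### Entrywise calculus for curves of matrices -/

section EntryDeriv

variable {n : Type}

/-- Entrywise differentiability of a curve of matrices. -/
def EntryDeriv (R : ℝ → Op n) (R' : Op n) (t : ℝ) : Prop :=
  ∀ i j, HasDerivAt (fun s => R s i j) (R' i j) t

variable {R Q : ℝ → Op n} {R' Q' : Op n} {t : ℝ}

theorem EntryDeriv.mul [Fintype n] (hR : EntryDeriv R R' t) (hQ : EntryDeriv Q Q' t) :
    EntryDeriv (fun s => R s * Q s) (R' * Q t + R t * Q') t := by
  intro i j
  simp only [Matrix.mul_apply, Matrix.add_apply, ← Finset.sum_add_distrib]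
  exact HasDerivAt.fun_sum fun k _ => (hR i k).mul (hQ k j)

theorem EntryDeriv.conjTranspose (hR : EntryDeriv R R' t) :
    EntryDeriv (fun s => (R s)ᴴ) R'ᴴ t := by
  intro i j
  simp only [Matrix.conjTranspose_apply]
  exact (hR j i).star

theorem EntryDeriv.trace [Fintype n] (hR : EntryDeriv R R' t) :
    HasDerivAt (fun s => (R s).trace) R'.trace t := by
  simp only [Matrix.trace, Matrix.diag]
  exact HasDerivAt.fun_sum fun k _ => hR k k

theorem EntryDeriv.comp_const_sub {c : ℝ} (hR : EntryDeriv R R' (c - t)) :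
    EntryDeriv (fun s => R (c - s)) (-R') t := by
  intro i j
  simpa using (hR i j).comp_const_sub c t

theorem entryDeriv_const (A : Op n) (t : ℝ) : EntryDeriv (fun _ => A) 0 t :=
  fun i j => hasDerivAt_const t (A i j)

theorem linearMap_apply_eq_sum [Fintype n] {m : Type} [DecidableEq n] (Ψ : Op n →ₗ[ℂ] Op m)
    (X : Op n) (i j : m) : Ψ X i j = ∑ a, ∑ b, X a b * Ψ (Matrix.single a b 1) i j := by
  conv_lhs => rw [Matrix.matrix_eq_sum_single X]
  simp only [map_sum, Matrix.sum_apply]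
  refine Finset.sum_congr rfl fun a _ => Finset.sum_congr rfl fun b _ => ?_
  have h : Matrix.single a b (X a b) = X a b • Matrix.single a b 1 := by simp
  rw [h, map_smul, Matrix.smul_apply, smul_eq_mul]

theorem EntryDeriv.map [Fintype n] {m : Type} [DecidableEq n] (hR : EntryDeriv R R' t)
    (Φ : Op n →ₗ[ℂ] Op m) : EntryDeriv (fun s => Φ (R s)) (Φ R') t := by
  intro i j
  simp only [linearMap_apply_eq_sum Φ (R _), linearMap_apply_eq_sum Φ R']
  exact HasDerivAt.fun_sum fun a _ => HasDerivAt.fun_sum fun b _ => (hR a b).mul_const _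

end EntryDeriv

/-! ### Heisenberg duals of superoperators -/

section TraceDual

/-- A superoperator is real if it commutes with taking adjoints. -/
def IsReal {n : Type} (Φ : Op n →ₗ[ℂ] Op n) : Prop := ∀ X, Φ Xᴴ = (Φ X)ᴴ

theorem IsReal.isHermitian {n : Type} {Φ : Op n →ₗ[ℂ] Op n} (h : IsReal Φ) {A : Op n}
    (hA : A.IsHermitian) : (Φ A).IsHermitian := by
  rw [Matrix.IsHermitian, ← h, hA.eq]

variable {n : Type} [Fintype n] [DecidableEq n]

/-- The dual of a superoperator with respect to the bilinear trace pairing. -/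
def traceDual (Φ : Op n →ₗ[ℂ] Op n) : Op n →ₗ[ℂ] Op n where
  toFun A := Matrix.of fun i j => (A * Φ (Matrix.single j i 1)).trace
  map_add' A B := by ext i j; simp [add_mul]
  map_smul' c A := by ext i j; simp

theorem trace_traceDual_mul (Φ : Op n →ₗ[ℂ] Op n) (A X : Op n) :
    (traceDual Φ A * X).trace = (A * Φ X).trace := by
  have h : ∀ j i, (A * Φ (Matrix.single j i (X j i))).trace = X j i * traceDual Φ A i j := by
    intro j i
    have h : Matrix.single j i (X j i) = X j i • Matrix.single j i 1 := by simp
    rw [h, map_smul, mul_smul_comm, Matrix.trace_smul, smul_eq_mul]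
    rfl
  conv_rhs => rw [Matrix.matrix_eq_sum_single X]
  simp only [map_sum, Finset.mul_sum, Matrix.trace_sum, h]
  rw [Finset.sum_comm]
  simp [Matrix.trace, Matrix.mul_apply, mul_comm]

theorem IsReal.traceDual {Φ : Op n →ₗ[ℂ] Op n} (h : IsReal Φ) : IsReal (traceDual Φ) := by
  intro A
  rw [Matrix.ext_iff_trace_mul_right]
  intro X
  rw [trace_traceDual_mul, ← Matrix.conjTranspose_conjTranspose X, h, ← Matrix.conjTranspose_mul,
    ← Matrix.conjTranspose_mul, Matrix.trace_conjTranspose, Matrix.trace_conjTranspose,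
    Matrix.trace_mul_comm, ← trace_traceDual_mul, Matrix.trace_mul_comm]

end TraceDual

/-! ### Duality and uniqueness for superoperator semigroups -/

section Semigroup

variable {n : Type} [Fintype n] [DecidableEq n]

theorem entryDeriv_semigroup (𝓛 : Op n →ₗ[ℂ] Op n) (ρ : Op n) (t : ℝ) :
    EntryDeriv (fun s => semigroup 𝓛 s ρ) (𝓛 (semigroup 𝓛 t ρ)) t :=
  semigroup_hasDerivAt 𝓛 ρ t

theorem entryDeriv_semigroup_backward (𝓛 : Op n →ₗ[ℂ] Op n) (A : Op n) (t s : ℝ) :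
    EntryDeriv (fun s => semigroup 𝓛 (t - s) A) (-(𝓛 (semigroup 𝓛 (t - s) A))) s :=
  (entryDeriv_semigroup 𝓛 A (t - s)).comp_const_sub

/-- Pairing the observable evolved backwards with the state evolved forwards gives a function of `s`
with zero derivative; its values at `s = t` and `s = 0` are the two sides. -/
theorem trace_mul_of_entryDeriv {𝓛 : Op n →ₗ[ℂ] Op n} {R : ℝ → Op n}
    (hR : ∀ s, EntryDeriv R (𝓛 (R s)) s) (A : Op n) (t : ℝ) :
    (A * R t).trace = (semigroup (traceDual 𝓛) t A * R 0).trace := by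
  have hd : ∀ s, HasDerivAt (fun s => (semigroup (traceDual 𝓛) (t - s) A * R s).trace) 0 s := by
    intro s
    have h := ((entryDeriv_semigroup_backward (traceDual 𝓛) A t s).mul (hR s)).trace
    rwa [neg_mul, Matrix.trace_add, Matrix.trace_neg, trace_traceDual_mul, neg_add_cancel] at h
  have h := is_const_of_deriv_eq_zero (fun s => (hd s).differentiableAt)
    (fun s => (hd s).deriv) t 0
  simpa [semigroup_zero] using h

theorem trace_semigroup_traceDual_mul (𝓛 : Op n →ₗ[ℂ] Op n) (A ρ : Op n) (t : ℝ) :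
    (semigroup (traceDual 𝓛) t A * ρ).trace = (A * semigroup 𝓛 t ρ).trace := by
  simpa [semigroup_zero] using
    (trace_mul_of_entryDeriv (fun s => entryDeriv_semigroup 𝓛 ρ s) A t).symm

/-- Uniqueness by duality: every trace pairing with `R t` is already determined by `R 0`. -/
theorem eq_semigroup_of_entryDeriv {𝓛 : Op n →ₗ[ℂ] Op n} {R : ℝ → Op n}
    (hR : ∀ s, EntryDeriv R (𝓛 (R s)) s) (t : ℝ) : R t = semigroup 𝓛 t (R 0) := by
  rw [Matrix.ext_iff_trace_mul_left]
  intro A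
  rw [trace_mul_of_entryDeriv hR, trace_semigroup_traceDual_mul]

theorem IsReal.semigroup {𝓛 : Op n →ₗ[ℂ] Op n} (h : IsReal 𝓛) (t : ℝ) :
    IsReal (semigroup 𝓛 t) := by
  intro X
  have := eq_semigroup_of_entryDeriv (𝓛 := 𝓛) (R := fun s => (HMM.semigroup 𝓛 s X)ᴴ)
    (fun s => by rw [h]; exact (entryDeriv_semigroup 𝓛 X s).conjTranspose) t
  simpa [semigroup_zero] using this.symm

theorem trace_semigroup {𝓛 : Op n →ₗ[ℂ] Op n} (h : ∀ X, (𝓛 X).trace = 0) (ρ : Op n) (t : ℝ) :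
    (semigroup 𝓛 t ρ).trace = ρ.trace := by
  have hd : ∀ s, HasDerivAt (fun s => (semigroup 𝓛 s ρ).trace) 0 s := fun s => by
    simpa [h] using (entryDeriv_semigroup 𝓛 ρ s).trace
  have := is_const_of_deriv_eq_zero (fun s => (hd s).differentiableAt)
    (fun s => (hd s).deriv) t 0
  simpa [semigroup_zero] using this

end Semigroup

/-! ### Trace, reality and carré du champ of the Lindblad generator -/

section Lindblad

variable {n : Type} [Fintype n] {r : ℕ}

theorem lindbladian_apply (H : Op n) (L : Fin r → Op n) (ρ : Op n) :
    lindbladian H L ρ = -Complex.I • (H * ρ - ρ * H) +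
    ∑ k, (L k * ρ * (L k)ᴴ - (1 / 2 : ℂ) • ((L k)ᴴ * L k * ρ + ρ * ((L k)ᴴ * L k))) := rfl

theorem trace_lindbladian (H : Op n) (L : Fin r → Op n) (ρ : Op n) :
    (lindbladian H L ρ).trace = 0 := by
  rw [lindbladian_apply, Matrix.trace_add, Matrix.trace_smul, Matrix.trace_sub,
    Matrix.trace_mul_comm H, sub_self, smul_zero, zero_add, Matrix.trace_sum]
  refine Finset.sum_eq_zero fun k _ => ?_
  rw [Matrix.trace_sub, Matrix.trace_smul, Matrix.trace_add, Matrix.trace_mul_cycle (L k),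
    Matrix.trace_mul_comm ρ, smul_eq_mul]
  ring

theorem isReal_lindbladian [DecidableEq n] {H : Op n} (hH : H.IsHermitian) (L : Fin r → Op n) :
    IsReal (lindbladian H L) := by
  intro X
  simp only [lindbladian_apply, Matrix.conjTranspose_add, Matrix.conjTranspose_smul,
    Matrix.conjTranspose_sub, Matrix.conjTranspose_mul, Matrix.conjTranspose_sum, hH.eq,
    Matrix.conjTranspose_conjTranspose]
  congr 1
  · simp only [star_neg, Complex.star_def, Complex.conj_I, neg_smul, smul_sub]
    abel
  · refine Finset.sum_congr rfl fun k _ => ?_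
    have : star (1 / 2 : ℂ) = 1 / 2 := by simp
    rw [this, add_comm]
    simp only [mul_assoc]

/-- The dissipation of an observable under a Lindblad generator. -/
theorem trace_lindbladian_carre_du_champ (H : Op n) (L : Fin r → Op n) (ρ : Op n) {B : Op n}
    (hB : B.IsHermitian) :
    (B * B * lindbladian H L ρ).trace - (B * lindbladian H L (B * ρ)).trace
      - (B * lindbladian H L (ρ * B)).trace =
    ∑ k, (ρ * ((L k * B - B * L k)ᴴ * (L k * B - B * L k))).trace := by
  -- Commutation with `H` is a derivation, so it has no carré du champ.
  have hHam : (B * B * (H * ρ - ρ * H)).trace - (B * (H * (B * ρ) - (B * ρ) * H)).trace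
      - (B * (H * (ρ * B) - (ρ * B) * H)).trace = 0 := by
    have e1 : (B * (ρ * (B * H))).trace = (B * (H * (B * ρ))).trace := by
      rw [← mul_assoc, Matrix.trace_mul_comm]; simp only [mul_assoc]
    have e2 : (B * (H * (ρ * B))).trace = (B * (B * (H * ρ))).trace := by
      rw [Matrix.trace_mul_comm B (B * _)]; simp only [mul_assoc]
    simp only [mul_sub, Matrix.trace_sub, mul_assoc, e1, e2]
    ring
  have hL : ∀ k, (B * B * (L k * ρ * (L k)ᴴ
        - (1 / 2 : ℂ) • ((L k)ᴴ * L k * ρ + ρ * ((L k)ᴴ * L k)))).trace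
      - (B * (L k * (B * ρ) * (L k)ᴴ
        - (1 / 2 : ℂ) • ((L k)ᴴ * L k * (B * ρ) + (B * ρ) * ((L k)ᴴ * L k)))).trace
      - (B * (L k * (ρ * B) * (L k)ᴴ
        - (1 / 2 : ℂ) • ((L k)ᴴ * L k * (ρ * B) + (ρ * B) * ((L k)ᴴ * L k)))).trace
      = (ρ * ((L k * B - B * L k)ᴴ * (L k * B - B * L k))).trace := by
    intro k
    generalize L k = K
    -- Cyclic rotations bring equal traces to one common word, after which only scalar arithmetic
    -- remains.
    have e1 : (ρ * (B * (Kᴴ * (K * B)))).trace = (B * (Kᴴ * (K * (B * ρ)))).trace := by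
      rw [Matrix.trace_mul_comm]; simp only [mul_assoc]
    have e2 : (ρ * (B * (Kᴴ * (B * K)))).trace = (B * (K * (ρ * (B * Kᴴ)))).trace := by
      rw [← mul_assoc, ← mul_assoc, Matrix.trace_mul_comm]; simp only [mul_assoc]
    have e3 : (ρ * (Kᴴ * (B * (K * B)))).trace = (B * (K * (B * (ρ * Kᴴ)))).trace := by
      rw [← mul_assoc, Matrix.trace_mul_comm]; simp only [mul_assoc]
    have e4 : (ρ * (Kᴴ * (B * (B * K)))).trace = (B * (B * (K * (ρ * Kᴴ)))).trace := by
      rw [← mul_assoc, Matrix.trace_mul_comm]; simp only [mul_assoc]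
    have e5 : (B * (ρ * (B * (Kᴴ * K)))).trace = (B * (Kᴴ * (K * (B * ρ)))).trace := by
      rw [← mul_assoc, Matrix.trace_mul_comm]; simp only [mul_assoc]
    have e6 : (B * (Kᴴ * (K * (ρ * B)))).trace = (B * (B * (Kᴴ * (K * ρ)))).trace := by
      rw [Matrix.trace_mul_comm B (B * _)]; simp only [mul_assoc]
    simp only [Matrix.conjTranspose_sub, Matrix.conjTranspose_mul, hB.eq, mul_sub, sub_mul,
      mul_add, Matrix.trace_sub, Matrix.trace_add, mul_smul_comm, Matrix.trace_smul, mul_assoc,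
      e1, e2, e3, e4, e5, e6, smul_eq_mul]
    ring
  simp only [lindbladian_apply, mul_add, Matrix.trace_add, mul_smul_comm, Matrix.trace_smul,
    Finset.mul_sum, Matrix.trace_sum]
  rw [← Finset.sum_congr rfl fun k _ => hL k, Finset.sum_sub_distrib, Finset.sum_sub_distrib]
  linear_combination (-Complex.I) * hHam

end Lindblad

/-! ### A Chernoff product formula -/

section ProductFormula

open Filter Topology

variable {𝔸 : Type} [NormedRing 𝔸]

theorem norm_pow_mul_le {x : 𝔸} {m : ℝ} (hx : ‖x‖ ≤ m) (d : 𝔸) (k : ℕ) :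
    ‖x ^ k * d‖ ≤ m ^ k * ‖d‖ := by
  have hm : 0 ≤ m := (norm_nonneg x).trans hx
  induction k with
  | zero => simp
  | succ k ih =>
    rw [pow_succ', mul_assoc, pow_succ', mul_assoc]
    exact (norm_mul_le _ _).trans (mul_le_mul hx ih (norm_nonneg _) hm)

/-- Telescoping: the difference of powers is a sum of `k + 1` products, each with one factor `x - y`
and `k` factors of norm at most `m`. -/
theorem norm_pow_sub_pow_le {x y : 𝔸} {m : ℝ} (hx : ‖x‖ ≤ m) (hy : ‖y‖ ≤ m) (k : ℕ) :
    ‖x ^ (k + 1) - y ^ (k + 1)‖ ≤ (k + 1) * m ^ k * ‖x - y‖ := by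
  induction k with
  | zero => simp
  | succ k ih =>
    have e : x ^ (k + 1 + 1) - y ^ (k + 1 + 1) =
        x ^ (k + 1) * (x - y) + (x ^ (k + 1) - y ^ (k + 1)) * y := by
      rw [pow_succ x, pow_succ y]; noncomm_ring
    have h2 : ‖(x ^ (k + 1) - y ^ (k + 1)) * y‖ ≤ (k + 1) * m ^ k * ‖x - y‖ * m :=
      (norm_mul_le _ _).trans (mul_le_mul ih hy (norm_nonneg _) ((norm_nonneg _).trans ih))
    rw [e]
    refine (norm_add_le _ _).trans ((add_le_add (norm_pow_mul_le hx _ _) h2).trans_eq ?_)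
    push_cast
    ring

variable [NormedAlgebra ℝ 𝔸] [NormOneClass 𝔸]

theorem eventually_norm_le_of_hasDerivAt {x : ℝ → 𝔸} {a : 𝔸} (hx : HasDerivAt x a 0)
    (hx0 : x 0 = 1) : ∀ᶠ s in 𝓝 (0 : ℝ), ‖x s‖ ≤ 1 + (‖a‖ + 1) * |s| := by
  filter_upwards [(hasDerivAt_iff_isLittleO.1 hx).bound one_pos] with s hs
  rw [hx0, sub_zero, one_mul, Real.norm_eq_abs] at hs
  have e : x s = (x s - 1 - s • a) + (1 + s • a) := by abel
  rw [e]
  refine (norm_add_le _ _).trans ((add_le_add hs (norm_add_le _ _)).trans_eq ?_)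
  rw [norm_one, norm_smul, Real.norm_eq_abs]
  ring

/-- Curves through `1` with the same velocity have the same product limit. -/
theorem tendsto_pow_sub_pow_of_hasDerivAt {x y : ℝ → 𝔸} {a : 𝔸} (hx : HasDerivAt x a 0)
    (hy : HasDerivAt y a 0) (hx0 : x 0 = 1) (hy0 : y 0 = 1) (t : ℝ) :
    Tendsto (fun k : ℕ => x (t / (k + 1 : ℕ)) ^ (k + 1) - y (t / (k + 1 : ℕ)) ^ (k + 1))
      atTop (𝓝 0) := by
  have hs : Tendsto (fun k : ℕ => t / ((k + 1 : ℕ) : ℝ)) atTop (𝓝 0) :=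
    (tendsto_const_div_atTop_nhds_zero_nat t).comp (tendsto_add_atTop_nat 1)
  have hd : HasDerivAt (fun s => x s - y s) 0 0 :=
    (hx.sub hy).congr_deriv (sub_self a)
  set c := ‖a‖ + 1 with hc
  have hc0 : 0 ≤ c := by positivity
  rw [Metric.tendsto_nhds]
  intro ε hε
  -- Chosen so that the final estimate `exp (c * |t|) * η * |t|` stays below `ε`, also when `t = 0`.
  set η := ε / (2 * (|t| + 1) * Real.exp (c * |t|)) with hη
  have hη0 : 0 < η := by positivity
  filter_upwards [hs.eventually (eventually_norm_le_of_hasDerivAt hx hx0),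
    hs.eventually (eventually_norm_le_of_hasDerivAt hy hy0),
    hs.eventually ((hasDerivAt_iff_isLittleO.1 hd).bound hη0)] with k h1 h2 h3
  rw [dist_zero_right]
  have hN : (0 : ℝ) < ((k + 1 : ℕ) : ℝ) := by positivity
  simp only [hx0, hy0, sub_self, sub_zero, smul_zero, Real.norm_eq_abs] at h3
  have hm : (1 + c * |t / ((k + 1 : ℕ) : ℝ)|) ^ k ≤ Real.exp (c * |t|) := by
    have h4 : 1 + c * |t / ((k + 1 : ℕ) : ℝ)| ≤ Real.exp (c * |t| / ((k + 1 : ℕ) : ℝ)) := by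
      rw [abs_div, abs_of_pos hN, ← mul_div_assoc, add_comm]
      exact Real.add_one_le_exp _
    calc _ ≤ (Real.exp (c * |t| / ((k + 1 : ℕ) : ℝ))) ^ k := by gcongr
      _ = Real.exp (k * (c * |t| / ((k + 1 : ℕ) : ℝ))) := (Real.exp_nat_mul _ _).symm
      _ ≤ Real.exp (c * |t|) := by
        apply Real.exp_le_exp.2
        rw [← mul_div_assoc, div_le_iff₀ hN, mul_comm]
        gcongr
        simp
  calc _ ≤ ((k : ℝ) + 1) * (1 + c * |t / ((k + 1 : ℕ) : ℝ)|) ^ k *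
        ‖x (t / ((k + 1 : ℕ) : ℝ)) - y (t / ((k + 1 : ℕ) : ℝ))‖ := norm_pow_sub_pow_le h1 h2 k
    _ ≤ ((k : ℝ) + 1) * Real.exp (c * |t|) * (η * |t / ((k + 1 : ℕ) : ℝ)|) := by gcongr
    _ = Real.exp (c * |t|) * η * |t| := by
      rw [abs_div, abs_of_pos hN]
      push_cast at hN ⊢
      field_simp
    _ = ε * (|t| / (2 * (|t| + 1))) := by rw [hη]; field_simp
    _ < ε * 1 := by
      apply mul_lt_mul_of_pos_left _ hε
      rw [div_lt_one (by positivity)]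
      linarith [abs_nonneg t]
    _ = ε := mul_one ε

end ProductFormula

/-! ### Positivity of the Lindblad semigroup -/

section Positivity

variable {n : Type} [Fintype n]

theorem isClosed_posSemidef : IsClosed {A : Op n | A.PosSemidef} := by
  simp only [Matrix.posSemidef_iff_dotProduct_mulVec, Matrix.IsHermitian, Set.ofPred_and,
    Set.ofPred_forall]
  refine IsClosed.inter (isClosed_eq (by fun_prop) continuous_id) (isClosed_iInter fun x => ?_)
  exact isClosed_le continuous_const
    (continuous_const.dotProduct (continuous_id.matrix_mulVec continuous_const))

variable [DecidableEq n]

theorem toLin_stdBasis_apply (B : Op (n × n)) (ρ : Op n) (i j : n) :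
    Matrix.toLin (Matrix.stdBasis ℂ n n) (Matrix.stdBasis ℂ n n) B ρ i j =
      ∑ q, B (i, j) q * (Matrix.stdBasis ℂ n n).repr ρ q := by
  have h : (Matrix.stdBasis ℂ n n).repr (Matrix.toLin (Matrix.stdBasis ℂ n n)
      (Matrix.stdBasis ℂ n n) B ρ) (i, j) =
      ∑ q, B (i, j) q * (Matrix.stdBasis ℂ n n).repr ρ q := by
    rw [Matrix.toLin_apply, Module.Basis.repr_sum_self]
    rfl
  exact h

open scoped Matrix.Norms.Operator in
/-- If a quadratic correction of `1 + ε𝓛` is positive for all `ε ≥ 0`, then `𝓛` generates a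
positive semigroup. -/
theorem posSemidef_semigroup {𝓛 𝓑 : Op n →ₗ[ℂ] Op n}
    (h : ∀ ε : ℝ, 0 ≤ ε → ∀ ρ : Op n, ρ.PosSemidef →
      (ρ + (ε : ℂ) • 𝓛 ρ + (ε : ℂ) ^ 2 • 𝓑 ρ).PosSemidef)
    {t : ℝ} (ht : 0 ≤ t) {ρ : Op n} (hρ : ρ.PosSemidef) : (semigroup 𝓛 t ρ).PosSemidef := by
  -- The product formula requires `‖1‖ = 1`, which fails for matrices over an empty index type.
  rcases isEmpty_or_nonempty n with hn | hn
  · rwa [Subsingleton.elim (semigroup 𝓛 t ρ) ρ]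
  set b := Matrix.stdBasis ℂ n n with hb
  set A := LinearMap.toMatrix b b 𝓛 with hA
  set B := LinearMap.toMatrix b b 𝓑 with hB
  set x : ℝ → Op (n × n) := fun s => 1 + (s : ℂ) • A + (s : ℂ) ^ 2 • B with hx
  set y : ℝ → Op (n × n) := fun s => NormedSpace.exp ((s : ℂ) • A) with hy
  have hx' : HasDerivAt x A 0 := by
    have h1 : HasDerivAt (fun s : ℝ => (s : ℂ)) 1 0 := Complex.ofRealCLM.hasDerivAt
    have h2 := ((h1.smul_const A).const_add (1 : Op (n × n))).add ((h1.pow 2).smul_const B)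
    exact h2.congr_deriv (by simp)
  have hy' : HasDerivAt y A 0 := by
    exact (hasDerivAt_exp_smul_const' (𝕂 := ℝ) A 0).congr_deriv (by simp)
  -- The quadratic correction does not change the velocity at `0`, so powers of the positive steps
  -- `x (t / N)` converge to the exponential; positivity passes to the limit by closedness.
  have hlim := tendsto_pow_sub_pow_of_hasDerivAt hx' hy' (by simp [hx]) (by simp [hy]) t
  have hpow : ∀ k : ℕ, y (t / (k + 1 : ℕ)) ^ (k + 1) = NormedSpace.exp ((t : ℂ) • A) := by
    intro k
    have hk : ((k + 1 : ℕ) : ℂ) ≠ 0 := Nat.cast_ne_zero.2 k.succ_ne_zero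
    rw [hy, ← Matrix.exp_nsmul, ← Nat.cast_smul_eq_nsmul ℂ, smul_smul]
    congr 2
    push_cast at hk ⊢
    field_simp
  simp only [hpow] at hlim
  have hlim' := hlim.add_const (NormedSpace.exp ((t : ℂ) • A))
  simp only [sub_add_cancel, zero_add] at hlim'
  have hcont : Continuous fun N : Op (n × n) => Matrix.toLin b b N ρ := by
    refine continuous_matrix fun i j => ?_
    simp only [hb, toLin_stdBasis_apply]
    fun_prop
  refine isClosed_posSemidef.mem_of_tendsto ((hcont.tendsto _).comp hlim')
    (Filter.Eventually.of_forall fun k => ?_)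
  have hstep : ∀ s : ℝ, 0 ≤ s → ∀ σ : Op n, σ.PosSemidef →
      (Matrix.toLin b b (x s) σ).PosSemidef := by
    intro s hs σ hσ
    have e : Matrix.toLin b b (x s) σ = σ + (s : ℂ) • 𝓛 σ + (s : ℂ) ^ 2 • 𝓑 σ := by
      simp only [hx, hA, hB, map_add, map_smul, Matrix.toLin_one, Matrix.toLin_toMatrix,
        LinearMap.add_apply, LinearMap.smul_apply, LinearMap.id_apply]
    rw [e]
    exact h s hs σ hσ
  have hiter : ∀ s : ℝ, 0 ≤ s → ∀ k : ℕ, (Matrix.toLin b b (x s ^ k) ρ).PosSemidef := by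
    intro s hs k
    induction k with
    | zero => simpa using hρ
    | succ k ih =>
      rw [pow_succ', Matrix.toLin_mul b b b]
      exact hstep s hs _ ih
  exact hiter _ (by positivity) _

/-- With the effective generator `W = -iH - ½ ∑ Lₖ† Lₖ`, adding `ε² W ρ W†` to the first-order step
completes it to `(1 + εW) ρ (1 + εW)† + ε ∑ Lₖ ρ Lₖ†`, which is manifestly positive. -/
theorem posSemidef_semigroup_lindbladian {r : ℕ} {H : Op n} (hH : H.IsHermitian)
    (L : Fin r → Op n) {t : ℝ} (ht : 0 ≤ t) {ρ : Op n} (hρ : ρ.PosSemidef) :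
    (semigroup (lindbladian H L) t ρ).PosSemidef := by
  set W : Op n := -Complex.I • H - (1 / 2 : ℂ) • ∑ k, (L k)ᴴ * L k with hW
  have hWH : Wᴴ = Complex.I • H - (1 / 2 : ℂ) • ∑ k, (L k)ᴴ * L k := by
    have : star (1 / 2 : ℂ) = 1 / 2 := by simp
    simp [hW, Matrix.conjTranspose_sum, hH.eq]
  have hL : ∀ σ, lindbladian H L σ = W * σ + σ * Wᴴ + ∑ k, L k * σ * (L k)ᴴ := by
    intro σ
    rw [hWH, hW, lindbladian_apply, Finset.sum_sub_distrib, ← Finset.smul_sum,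
      Finset.sum_add_distrib, ← Finset.sum_mul, ← Finset.mul_sum]
    simp only [sub_mul, mul_sub, smul_mul_assoc, mul_smul_comm, smul_add, smul_sub, neg_smul,
      neg_mul]
    abel
  refine posSemidef_semigroup
    (𝓑 := LinearMap.mulLeft ℂ W ∘ₗ LinearMap.mulRight ℂ Wᴴ) ?_ ht hρ
  intro ε hε σ hσ
  have e : σ + (ε : ℂ) • lindbladian H L σ +
      (ε : ℂ) ^ 2 • (LinearMap.mulLeft ℂ W ∘ₗ LinearMap.mulRight ℂ Wᴴ) σ =
      (1 + (ε : ℂ) • W) * σ * (1 + (ε : ℂ) • W)ᴴ +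
        (ε : ℂ) • ∑ k, L k * σ * (L k)ᴴ := by
    have : star (ε : ℂ) = ε := Complex.conj_ofReal ε
    simp only [hL, LinearMap.comp_apply, LinearMap.mulLeft_apply, LinearMap.mulRight_apply,
      Matrix.conjTranspose_add, Matrix.conjTranspose_one, Matrix.conjTranspose_smul, this,
      add_mul, mul_add, one_mul, mul_one, smul_mul_assoc, mul_smul_comm, smul_add, smul_smul,
      mul_assoc, sq]
    abel
  rw [e]
  refine (hσ.mul_mul_conjTranspose_same _).add (Matrix.PosSemidef.smul ?_
    (Complex.zero_le_real.2 hε))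
  exact Matrix.posSemidef_sum _ fun k _ => hσ.mul_mul_conjTranspose_same _

end Positivity

/-! ### Joint differentiability in parameter and time -/

section ParameterDependence

variable {n : Type} [Fintype n] [DecidableEq n] {𝓛 : ℝ → Op n →ₗ[ℂ] Op n} {𝓓 : Op n →ₗ[ℂ] Op n}

open scoped Matrix.Norms.Operator in
/-- The semigroup of an affine family of generators is jointly differentiable. -/
theorem differentiable_semigroup (h𝓛 : ∀ w, 𝓛 w = 𝓛 0 + (w : ℂ) • 𝓓) (ρ : Op n) (i j : n) :
    Differentiable ℝ fun p : ℝ × ℝ => semigroup (𝓛 p.1) p.2 ρ i j := by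
  have hexp : Differentiable ℝ (NormedSpace.exp : Op (n × n) → Op (n × n)) := fun A =>
    (NormedSpace.exp_analytic (𝕂 := ℝ) A).differentiableAt
  set b := Matrix.stdBasis ℂ n n with hb
  have hgen : Differentiable ℝ fun p : ℝ × ℝ =>
      (p.2 : ℂ) • (LinearMap.toMatrix b b (𝓛 0) + (p.1 : ℂ) • LinearMap.toMatrix b b 𝓓) := by
    have h1 : Differentiable ℝ fun p : ℝ × ℝ => (p.1 : ℂ) :=
      Complex.ofRealCLM.differentiable.comp differentiable_fst
    have h2 : Differentiable ℝ fun p : ℝ × ℝ => (p.2 : ℂ) :=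
      Complex.ofRealCLM.differentiable.comp differentiable_snd
    exact h2.smul ((h1.smul_const _).const_add _)
  have hcomp := hexp.comp hgen
  have hentry : ∀ q, Differentiable ℝ fun p : ℝ × ℝ => NormedSpace.exp
      ((p.2 : ℂ) • (LinearMap.toMatrix b b (𝓛 0) + (p.1 : ℂ) • LinearMap.toMatrix b b 𝓓))
      (i, j) q := fun q =>
    differentiable_pi.1 (differentiable_pi.1 hcomp (i, j)) q
  have e : (fun p : ℝ × ℝ => semigroup (𝓛 p.1) p.2 ρ i j) = fun p : ℝ × ℝ => ∑ q,
      NormedSpace.exp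
        ((p.2 : ℂ) • (LinearMap.toMatrix b b (𝓛 0) + (p.1 : ℂ) • LinearMap.toMatrix b b 𝓓))
        (i, j) q * b.repr ρ q := by
    funext p
    rw [semigroup, toLin_stdBasis_apply, h𝓛 p.1, map_add, map_smul]
  rw [e]
  exact Differentiable.fun_sum fun q _ => (hentry q).mul_const _

end ParameterDependence

/-! ### Growth of the Fisher bound under free evolution -/

section FreeEvolution

open Filter Topology

variable {n : Type} [Fintype n]

/-- The variational form of the statement that the quantum Fisher information of the state `ρ`
with parameter derivative `X` is at most `c`. -/
def FisherBound (ρ X : Op n) (c : ℝ) : Prop :=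
  ∀ A : Op n, A.IsHermitian → 2 * (A * X).trace.re - (A * A * ρ).trace.re ≤ c

/-- The dissipation rate of the second moment of an observable `A`. -/
def dissipation {r : ℕ} (L : Fin r → Op n) (ρ A : Op n) : ℝ :=
  ∑ k, (ρ * ((L k * A - A * L k)ᴴ * (L k * A - A * L k))).trace.re

/-- The signal commutator is controlled by the dissipation with constant `K`. -/
def SignalBound {r : ℕ} (S : Op n) (L : Fin r → Op n) (K : ℝ) : Prop :=
  ∀ ρ A : Op n, IsDensity ρ → A.IsHermitian →
    2 * (Complex.I * (ρ * (S * A - A * S)).trace).re ≤ K + dissipation L ρ A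

/-- The derivation `ρ ↦ -i[S, ρ]`. -/
def hamiltonian (S : Op n) : Op n →ₗ[ℂ] Op n := lindbladian S (Fin.elim0 : Fin 0 → Op n)

theorem hamiltonian_apply (S ρ : Op n) :
    hamiltonian S ρ = -Complex.I • (S * ρ - ρ * S) := by
  simp [hamiltonian, lindbladian_apply]

theorem lindbladian_add_smul {r : ℕ} (H S : Op n) (L : Fin r → Op n) (w : ℂ) :
    lindbladian (H + w • S) L = lindbladian H L + w • hamiltonian S := by
  refine LinearMap.ext fun ρ => ?_
  rw [LinearMap.add_apply, LinearMap.smul_apply, hamiltonian_apply, lindbladian_apply,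
    lindbladian_apply]
  simp only [add_mul, mul_add, smul_mul_assoc, mul_smul_comm, smul_sub, smul_add,
    smul_comm w]
  abel

theorem isHermitian_add_real_smul {n : Type} {H S : Op n} (hH : H.IsHermitian) (hS : S.IsHermitian)
    (w : ℝ) : (H + (w : ℂ) • S).IsHermitian := by
  rw [Matrix.IsHermitian, Matrix.conjTranspose_add, Matrix.conjTranspose_smul, hH.eq, hS.eq,
    Complex.star_def, Complex.conj_ofReal]

variable [DecidableEq n]

theorem IsDensity.semigroup_lindbladian {r : ℕ} {H : Op n} (hH : H.IsHermitian)
    (L : Fin r → Op n) {t : ℝ} (ht : 0 ≤ t) {ρ : Op n} (hρ : IsDensity ρ) :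
    IsDensity (semigroup (lindbladian H L) t ρ) :=
  ⟨posSemidef_semigroup_lindbladian hH L ht hρ.1,
    (trace_semigroup (trace_lindbladian H L) ρ t).trans hρ.2⟩

/-- Product rule: one term propagates the derivative already accumulated, the other is the fresh
response of the evolution to the parameter. -/
theorem EntryDeriv.apply_family {Φ : ℝ → Op n →ₗ[ℂ] Op n} {ρ : ℝ → Op n} {X Z : Op n} {ω : ℝ}
    (hΦ : ∀ σ i j, DifferentiableAt ℝ (fun w => Φ w σ i j) ω)
    (hZ : EntryDeriv (fun w => Φ w (ρ ω)) Z ω)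
    (hρ : EntryDeriv ρ X ω) : EntryDeriv (fun w => Φ w (ρ w)) (Φ ω X + Z) ω := by
  intro i j
  have h1 : HasDerivAt (fun w => Φ w (ρ w) i j) (∑ a, ∑ b, (X a b * Φ ω (Matrix.single a b 1) i j
      + ρ ω a b * deriv (fun w => Φ w (Matrix.single a b 1) i j) ω)) ω := by
    simp only [fun w => linearMap_apply_eq_sum (Φ w) (ρ w)]
    exact HasDerivAt.fun_sum fun a _ => HasDerivAt.fun_sum fun b _ =>
      (hρ a b).mul (hΦ _ i j).hasDerivAt
  have h2 : HasDerivAt (fun w => Φ w (ρ ω) i j)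
      (∑ a, ∑ b, ρ ω a b * deriv (fun w => Φ w (Matrix.single a b 1) i j) ω) ω := by
    simp only [fun w => linearMap_apply_eq_sum (Φ w) (ρ ω)]
    exact HasDerivAt.fun_sum fun a _ => HasDerivAt.fun_sum fun b _ =>
      (hΦ _ i j).hasDerivAt.const_mul _
  refine h1.congr_deriv ?_
  rw [Matrix.add_apply, (hZ i j).unique h2, linearMap_apply_eq_sum (Φ ω) X]
  simp only [Finset.sum_add_distrib]

section

variable {r : ℕ} {H S : Op n} {L : Fin r → Op n}

/-- Differential form of Duhamel's formula; it is applied to the generators at `ω` and at a nearby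
`w`. -/
theorem hasDerivAt_trace_backward_mul_forward (𝓛 𝓜 : Op n →ₗ[ℂ] Op n) (A ρ : Op n) (t s : ℝ) :
    HasDerivAt
      (fun s => (semigroup (traceDual 𝓛) (t - s) A * semigroup 𝓜 s ρ).trace)
      ((semigroup (traceDual 𝓛) (t - s) A * (𝓜 - 𝓛) (semigroup 𝓜 s ρ)).trace) s := by
  refine ((entryDeriv_semigroup_backward _ A t s).mul
    (entryDeriv_semigroup 𝓜 ρ s)).trace.congr_deriv ?_
  rw [neg_mul, Matrix.trace_add, Matrix.trace_neg, trace_traceDual_mul, LinearMap.sub_apply,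
    mul_sub, Matrix.trace_sub]
  ring

/-- The product rule yields exactly the three traces of `trace_lindbladian_carre_du_champ`, once
duality moves the generator off each copy of the observable. -/
theorem hasDerivAt_trace_backward_sq_mul_forward (hH : H.IsHermitian) {A : Op n}
    (hA : A.IsHermitian) (ρ : Op n) (t s : ℝ) :
    HasDerivAt
      (fun s => (semigroup (traceDual (lindbladian H L)) (t - s) A *
        semigroup (traceDual (lindbladian H L)) (t - s) A *
          semigroup (lindbladian H L) s ρ).trace.re)
      (dissipation L (semigroup (lindbladian H L) s ρ)
        (semigroup (traceDual (lindbladian H L)) (t - s) A)) s := by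
  have hB := ((isReal_lindbladian hH L).traceDual.semigroup (t - s)).isHermitian hA
  have h := (((entryDeriv_semigroup_backward (traceDual (lindbladian H L)) A t s).mul
    (entryDeriv_semigroup_backward (traceDual (lindbladian H L)) A t s)).mul
    (entryDeriv_semigroup (lindbladian H L) ρ s)).trace
  refine (Complex.reCLM.hasFDerivAt.comp_hasDerivAt s h).congr_deriv ?_
  rw [dissipation, ← Complex.re_sum, ← trace_lindbladian_carre_du_champ H L _ hB]
  generalize semigroup (traceDual (lindbladian H L)) (t - s) A = B
  generalize semigroup (lindbladian H L) s ρ = R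
  have e1 : (traceDual (lindbladian H L) B * B * R).trace =
      (B * lindbladian H L (B * R)).trace := by rw [mul_assoc, trace_traceDual_mul]
  have e2 : (B * traceDual (lindbladian H L) B * R).trace =
      (B * lindbladian H L (R * B)).trace := by
    rw [mul_assoc, Matrix.trace_mul_comm, mul_assoc, trace_traceDual_mul]
  rw [Complex.reCLM_apply, Matrix.trace_add, add_mul, Matrix.trace_add, neg_mul, neg_mul,
    mul_neg, neg_mul, Matrix.trace_neg, Matrix.trace_neg, e1, e2]
  congr 1
  ring

theorem re_trace_mul_hamiltonian (S B R : Op n) :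
    (B * hamiltonian S R).trace.re = (Complex.I * (R * (S * B - B * S)).trace).re := by
  have e1 : (R * (S * B)).trace = (B * (R * S)).trace := by
    rw [← mul_assoc, Matrix.trace_mul_comm]
  have e2 : (R * (B * S)).trace = (B * (S * R)).trace := by
    rw [Matrix.trace_mul_comm, mul_assoc]
  rw [hamiltonian_apply, mul_smul_comm, Matrix.trace_smul, mul_sub, mul_sub, Matrix.trace_sub,
    Matrix.trace_sub, e1, e2, smul_eq_mul]
  congr 1
  ring

/-- The response of the free evolution to the signal is bounded by the growth of the second moment
of the observable. -/
theorem re_trace_mul_response_le (hH : H.IsHermitian) (hS : S.IsHermitian) {K : ℝ}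
    (hK : SignalBound S L K) {ρ : Op n} (hρ : IsDensity ρ) {ω t : ℝ} (ht : 0 ≤ t) {Z : Op n}
    (hZ : EntryDeriv (fun w : ℝ => semigroup (lindbladian (H + (w : ℂ) • S) L) t ρ) Z ω)
    {A : Op n} (hA : A.IsHermitian) :
    2 * (A * Z).trace.re ≤
      (A * A * semigroup (lindbladian (H + (ω : ℂ) • S) L) t ρ).trace.re
      - (semigroup (traceDual (lindbladian (H + (ω : ℂ) • S) L)) t A *
          semigroup (traceDual (lindbladian (H + (ω : ℂ) • S) L)) t A * ρ).trace.re
      + K * t := by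
  set 𝓛 : ℝ → Op n →ₗ[ℂ] Op n := fun w => lindbladian (H + (w : ℂ) • S) L with h𝓛
  have hHω : (H + (ω : ℂ) • S).IsHermitian := isHermitian_add_real_smul hH hS ω
  have haff : ∀ w, 𝓛 w = 𝓛 0 + (w : ℂ) • hamiltonian S := by
    intro w
    simp only [h𝓛, lindbladian_add_smul, Complex.ofReal_zero, zero_smul, add_zero]
  have hdiff : ∀ w, 𝓛 w - 𝓛 ω = ((w - ω : ℝ) : ℂ) • hamiltonian S := by
    intro w
    refine LinearMap.ext fun σ => ?_
    rw [haff w, haff ω, Complex.ofReal_sub]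
    simp only [LinearMap.sub_apply, LinearMap.add_apply, LinearMap.smul_apply, sub_smul]
    abel
  set B : ℝ → Op n := fun s => semigroup (traceDual (𝓛 ω)) (t - s) A with hB
  set R : ℝ × ℝ → Op n := fun p => semigroup (𝓛 p.1) p.2 ρ with hR
  set u : ℝ × ℝ → ℝ := fun p => 2 * (B p.2 * hamiltonian S (R p)).trace.re with hu
  have hBc : Continuous B := continuous_matrix fun i j => continuous_iff_continuousAt.2 fun s =>
    (entryDeriv_semigroup_backward (traceDual (𝓛 ω)) A t s i j).continuousAt
  have hRc : Continuous R := continuous_matrix fun i j =>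
    (differentiable_semigroup haff ρ i j).continuous
  have huc : Continuous u := by
    simp only [hu, hamiltonian_apply]
    have h1 : Continuous fun p => -Complex.I • (S * R p - R p * S) :=
      Continuous.const_smul (g := fun p => S * R p - R p * S) (Continuous.sub
        (continuous_const.matrix_mul hRc) (hRc.matrix_mul continuous_const)) (-Complex.I)
    exact continuous_const.mul (Complex.continuous_re.comp
      ((hBc.comp continuous_snd).matrix_mul h1).matrix_trace)
  have hZ' : HasDerivAt (fun w => (A * R (w, t)).trace.re) (A * Z).trace.re ω := by
    have := ((entryDeriv_const A ω).mul hZ).trace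
    rw [zero_mul, zero_add] at this
    exact Complex.reCLM.hasFDerivAt.comp_hasDerivAt ω this
  -- The bound is proved for difference quotients at `w` near `ω`, with slack `ε`; this avoids
  -- differentiating an integral in the parameter.
  have hεbound : ∀ ε : ℝ, 0 < ε → 2 * (A * Z).trace.re ≤
      ((A * A * R (ω, t)).trace.re - (B 0 * B 0 * ρ).trace.re) + (K + ε) * t := by
    intro ε hε
    -- Compactness of `[0, t]` makes the slack uniform in `s`.
    have hnear : ∀ᶠ w in 𝓝 ω, ∀ s ∈ Set.Icc 0 t, u (w, s) - u (ω, s) < ε := by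
      refine isCompact_Icc.eventually_forall_of_forall_eventually fun s _ => ?_
      have hc : Continuous fun p : ℝ × ℝ => u (p.1, p.2) - u (ω, p.2) :=
        huc.sub (huc.comp (continuous_const.prodMk continuous_snd))
      exact (hc.tendsto (ω, s)).eventually_lt_const (by simpa using hε)
    have hslope := (hasDerivAt_iff_tendsto_slope.1 hZ').const_mul 2
    refine le_of_tendsto hslope ?_
    filter_upwards [hnear.filter_mono nhdsWithin_le_nhds, self_mem_nhdsWithin] with w hw hne
    have hwω : w - ω ≠ 0 := sub_ne_zero.2 hne
    -- The signal term of `f'` is evaluated along `w` but the dissipation along `ω`. The signal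
    -- bound holds along `ω`, and the slack `ε` pays for the mismatch, so `f` decreases.
    set f : ℝ → ℝ := fun s => 2 * ((w - ω)⁻¹ * (B s * R (w, s)).trace.re)
      - (B s * B s * R (ω, s)).trace.re - (K + ε) * s with hf
    have hf' : ∀ s, HasDerivAt f (u (w, s) - dissipation L (R (ω, s)) (B s) - (K + ε)) s := by
      intro s
      have h1 := Complex.reCLM.hasFDerivAt.comp_hasDerivAt s
        (hasDerivAt_trace_backward_mul_forward (𝓛 ω) (𝓛 w) A ρ t s)
      have h2 := hasDerivAt_trace_backward_sq_mul_forward (L := L) hHω hA ρ t s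
      refine ((((h1.const_mul (w - ω)⁻¹).const_mul 2).sub h2).sub
        ((hasDerivAt_id s).const_mul (K + ε))).congr_deriv ?_
      rw [hdiff, LinearMap.smul_apply, mul_smul_comm, Matrix.trace_smul, Complex.reCLM_apply,
        smul_eq_mul, Complex.re_ofReal_mul, inv_mul_cancel_left₀ hwω, mul_one]
    have hanti : AntitoneOn f (Set.Icc 0 t) := by
      refine antitoneOn_of_deriv_nonpos (convex_Icc 0 t)
        (fun s _ => (hf' s).continuousAt.continuousWithinAt)
        (fun s _ => (hf' s).differentiableAt.differentiableWithinAt) fun s hs => ?_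
      have hs' : s ∈ Set.Icc 0 t := interior_subset hs
      have hRs : IsDensity (R (ω, s)) := hρ.semigroup_lindbladian hHω L hs'.1
      have hBs : (B s).IsHermitian :=
        ((isReal_lindbladian hHω L).traceDual.semigroup (t - s)).isHermitian hA
      have h1 := hK _ _ hRs hBs
      rw [← re_trace_mul_hamiltonian] at h1
      have h2 := hw s hs'
      simp only [hu] at h2
      rw [(hf' s).deriv]
      simp only [hu]
      linarith
    -- The first terms of `f` at the two ends differ by twice the difference quotient, since
    -- `tr(B(0) ρ)` is the expectation of `A` at time `t` for parameter `ω`.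
    have h0t := hanti (Set.left_mem_Icc.2 ht) (Set.right_mem_Icc.2 ht) ht
    have hBt : B t = A := by simp [hB, semigroup_zero]
    have hR0 : ∀ w, R (w, 0) = ρ := fun w => by simp [hR, semigroup_zero]
    have hB0 : (B 0 * ρ).trace = (A * R (ω, t)).trace := by
      simp only [hB, hR, sub_zero]
      exact trace_semigroup_traceDual_mul _ _ _ _
    simp only [hf, hBt, hR0, hB0] at h0t
    rw [slope_def_field, div_eq_inv_mul]
    linarith
  have hB0 : B 0 = semigroup (traceDual (𝓛 ω)) t A := by simp [hB]
  rw [← hB0]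
  refine le_of_forall_pos_le_add fun ε hε => ?_
  have h1 := hεbound (ε / (t + 1)) (by positivity)
  have h2 : ε / (t + 1) * t ≤ ε := by
    rw [div_mul_eq_mul_div, div_le_iff₀ (by positivity)]
    nlinarith
  have e : (K + ε / (t + 1)) * t = K * t + ε / (t + 1) * t := add_mul _ _ _
  linarith

/-- Free evolution for time `t` increases the Fisher bound by at most `K * t`. -/
theorem FisherBound.free_evolution (hH : H.IsHermitian) (hS : S.IsHermitian) {K : ℝ}
    (hK : SignalBound S L K) {ρ : ℝ → Op n} {ω t c : ℝ} (hρ : IsDensity (ρ ω)) (ht : 0 ≤ t)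
    {X : Op n} (hX : EntryDeriv ρ X ω) (hc : FisherBound (ρ ω) X c) :
    ∃ Y, EntryDeriv (fun w : ℝ => semigroup (lindbladian (H + (w : ℂ) • S) L) t (ρ w)) Y ω ∧
      FisherBound (semigroup (lindbladian (H + (ω : ℂ) • S) L) t (ρ ω)) Y (c + K * t) := by
  have haff : ∀ w : ℝ, lindbladian (H + (w : ℂ) • S) L =
      lindbladian (H + ((0 : ℝ) : ℂ) • S) L + (w : ℂ) • hamiltonian S := by
    intro w
    simp only [lindbladian_add_smul, Complex.ofReal_zero, zero_smul, add_zero]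
  have hd : ∀ σ i j, DifferentiableAt ℝ
      (fun w : ℝ => semigroup (lindbladian (H + (w : ℂ) • S) L) t σ i j) ω := by
    intro σ i j
    have h1 := differentiable_semigroup (𝓛 := fun w : ℝ => lindbladian (H + (w : ℂ) • S) L)
      haff σ i j (ω, t)
    have h2 : DifferentiableAt ℝ (fun w : ℝ => (w, t)) ω := by fun_prop
    exact DifferentiableAt.comp (f := fun w : ℝ => (w, t)) (g := fun p : ℝ × ℝ =>
      semigroup (lindbladian (H + (p.1 : ℂ) • S) L) p.2 σ i j) ω h1 h2
  set Z : Op n := Matrix.of fun i j =>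
    deriv (fun w : ℝ => semigroup (lindbladian (H + (w : ℂ) • S) L) t (ρ ω) i j) ω with hZdef
  have hZ : EntryDeriv (fun w : ℝ => semigroup (lindbladian (H + (w : ℂ) • S) L) t (ρ ω)) Z ω :=
    fun i j => (hd (ρ ω) i j).hasDerivAt
  refine ⟨_, EntryDeriv.apply_family hd hZ hX, fun A hA => ?_⟩
  have hHω : (H + (ω : ℂ) • S).IsHermitian := isHermitian_add_real_smul hH hS ω
  have h1 := re_trace_mul_response_le hH hS hK hρ ht hZ hA
  -- The incoming bound is tested on the back-evolved observable; its second moment cancels the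
  -- negative term of `h1`.
  have h2 := hc _ (((isReal_lindbladian hHω L).traceDual.semigroup t).isHermitian hA)
  rw [trace_semigroup_traceDual_mul] at h2
  rw [mul_add, Matrix.trace_add, Complex.add_re]
  linarith

end

end FreeEvolution

/-! ### Kadison-Schwarz inequality and monotonicity -/

section Schwarz

variable {n : Type} [Fintype n]

/-- Two-positivity of a superoperator. -/
def IsTwoPositive (Ψ : Op n →ₗ[ℂ] Op n) : Prop :=
  ∀ M : Op (Fin 2 × n), M.PosSemidef → (ampliate Ψ M).PosSemidef

/-- Two operators stacked into a column. -/
def stack (a : Fin 2 → Op n) : Matrix (Fin 2 × n) n ℂ := Matrix.of fun x j => a x.1 x.2 j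

theorem ampliate_stack_apply (Ψ : Op n →ₗ[ℂ] Op n) (a : Fin 2 → Op n) (ρ : Op n)
    (x y : Fin 2 × n) :
    ampliate Ψ (stack a * ρ * (stack a)ᴴ) x y = Ψ (a x.1 * ρ * (a y.1)ᴴ) x.2 y.2 := by
  have h : (Matrix.of fun i j => (stack a * ρ * (stack a)ᴴ) (x.1, i) (y.1, j)) =
      a x.1 * ρ * (a y.1)ᴴ := by
    ext i j
    simp [Matrix.mul_apply, stack]
  rw [ampliate, Matrix.of_apply, h]

theorem stack_conj (b : Fin 2 → Op n) (M : Op (Fin 2 × n)) :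
    (stack b)ᴴ * M * stack b =
      ∑ x, ∑ y, (b x)ᴴ * (Matrix.of fun i j => M (x, i) (y, j)) * b y := by
  ext i j
  simp only [Matrix.mul_apply, Fintype.sum_prod_type, Matrix.conjTranspose_apply, stack,
    Matrix.of_apply, Matrix.sum_apply, Finset.sum_mul]
  simp only [Fin.sum_univ_two, Finset.sum_add_distrib]
  ring

/-- The positive block matrix with rows `(XX†, X)` and `(X†, 1)` has a Hermitian image, so its
off-diagonal blocks are adjoint to each other. -/
theorem IsTwoPositive.isReal [DecidableEq n] {Ψ : Op n →ₗ[ℂ] Op n} (h : IsTwoPositive Ψ) :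
    IsReal Ψ := by
  intro X
  have hH := (h _ (Matrix.PosSemidef.one.mul_mul_conjTranspose_same (stack ![X, 1]))).isHermitian
  ext i j
  have := hH.apply (1, i) (0, j)
  rw [ampliate_stack_apply, ampliate_stack_apply] at this
  simpa using this.symm

/-- With `B` the dual of `A`, ampliate the positive matrix built from the column `(B, -1)` and `ρ`,
then compress by the column `(1, A)`. By trace preservation and duality the trace is `tr(B²ρ) - 2
tr(B²ρ) + tr(A² Ψρ)`, hence nonnegative. -/
theorem IsTwoPositive.trace_sq_le [DecidableEq n] {Ψ : Op n →ₗ[ℂ] Op n} (h : IsTwoPositive Ψ)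
    (htr : ∀ ρ, (Ψ ρ).trace = ρ.trace) {A ρ : Op n} (hA : A.IsHermitian)
    (hρ : ρ.PosSemidef) :
    (traceDual Ψ A * traceDual Ψ A * ρ).trace.re ≤ (A * A * Ψ ρ).trace.re := by
  have hB := h.isReal.traceDual.isHermitian hA
  set B := traceDual Ψ A with hBdef
  have hpos := ((h _ (hρ.mul_mul_conjTranspose_same (stack ![B, -1]))).conjTranspose_mul_mul_same
    (stack ![1, A])).trace_nonneg
  rw [stack_conj] at hpos
  have hblock : ∀ x y : Fin 2, (Matrix.of fun i j =>
      ampliate Ψ (stack ![B, -1] * ρ * (stack ![B, -1])ᴴ) (x, i) (y, j)) =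
      Ψ (![B, -1] x * ρ * (![B, -1] y)ᴴ) := by
    intro x y
    ext i j
    rw [Matrix.of_apply, ampliate_stack_apply]
  have e1 : (Ψ (B * ρ * B)).trace = (B * B * ρ).trace := by
    rw [htr, Matrix.trace_mul_comm, mul_assoc]
  have e2 : (Ψ (B * ρ) * A).trace = (B * B * ρ).trace := by
    rw [Matrix.trace_mul_comm, ← trace_traceDual_mul, ← mul_assoc]
  have e3 : (A * Ψ (ρ * B)).trace = (B * B * ρ).trace := by
    rw [← trace_traceDual_mul, ← mul_assoc, Matrix.trace_mul_comm, ← mul_assoc]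
  have e4 : (A * Ψ ρ * A).trace = (A * A * Ψ ρ).trace := by
    rw [Matrix.trace_mul_comm, mul_assoc]
  simp only [hblock, Fin.sum_univ_two, Matrix.cons_val_zero, Matrix.cons_val_one,
    Matrix.conjTranspose_one, Matrix.conjTranspose_neg, hA.eq, hB.eq, one_mul, mul_one, neg_mul,
    mul_neg, neg_neg, map_neg, Matrix.trace_add, Matrix.trace_neg, e1, e2, e3, e4] at hpos
  have := (Complex.le_def.1 hpos).1
  simp only [Complex.add_re, Complex.neg_re, Complex.zero_re] at this
  linarith

theorem FisherBound.map [DecidableEq n] {Ψ : Op n →ₗ[ℂ] Op n} (h : IsTwoPositive Ψ)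
    (htr : ∀ ρ, (Ψ ρ).trace = ρ.trace) {ρ X : Op n} {c : ℝ} (hρ : ρ.PosSemidef)
    (hc : FisherBound ρ X c) : FisherBound (Ψ ρ) (Ψ X) c := by
  intro A hA
  have h1 := hc _ (h.isReal.traceDual.isHermitian hA)
  have h2 := h.trace_sq_le htr hA hρ
  rw [trace_traceDual_mul] at h1
  linarith

end Schwarz

/-! ### Control operations as two-positive maps -/

section Control

variable {n : Type} [Fintype n] {k : ℕ}

/-- The ampliation of a superoperator as a linear map. -/
def ampliateLinear {k n : Type} (Φ : Op n →ₗ[ℂ] Op n) : Op (k × n) →ₗ[ℂ] Op (k × n) where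
  toFun := ampliate Φ
  map_add' ρ σ := by
    ext x y
    exact congrFun (congrFun (Φ.map_add (Matrix.of fun a b => ρ (x.1, a) (y.1, b))
      (Matrix.of fun a b => σ (x.1, a) (y.1, b))) x.2) y.2
  map_smul' c ρ := by
    ext x y
    exact congrFun (congrFun (Φ.map_smul c (Matrix.of fun a b => ρ (x.1, a) (y.1, b))) x.2) y.2

theorem IsCPTP.trace_ampliate {Φ : Op n →ₗ[ℂ] Op n} (h : IsCPTP Φ) (ρ : Op (Fin k × n)) :
    (ampliateLinear Φ ρ).trace = ρ.trace := by
  simp only [Matrix.trace, Fintype.sum_prod_type]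
  exact Finset.sum_congr rfl fun e _ =>
    h.trace_preserving (Matrix.of fun a b => ρ (e, a) (e, b))

/-- Ampliating twice, by `2` and by `k`, is one ampliation by `2 * k` after reindexing. -/
theorem IsCPTP.isTwoPositive_ampliate {Φ : Op n →ₗ[ℂ] Op n} (h : IsCPTP Φ) :
    IsTwoPositive (ampliateLinear (k := Fin k) Φ) := by
  intro M hM
  set e : Fin (2 * k) × n → Fin 2 × (Fin k × n) := fun x =>
    ((finProdFinEquiv.symm x.1).1, ((finProdFinEquiv.symm x.1).2, x.2)) with he
  have h1 := h.completely_positive _ _ (hM.submatrix e)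
  have h2 := h1.submatrix fun x : Fin 2 × (Fin k × n) => (finProdFinEquiv (x.1, x.2.1), x.2.2)
  convert h2 using 1
  ext x y
  simp only [ampliate, ampliateLinear, he, Matrix.submatrix_apply, Matrix.of_apply,
    LinearMap.coe_mk, AddHom.coe_mk, Equiv.symm_apply_apply]

end Control

/-! ### Discarding the environment -/

section PartialTrace

variable {k n : Type} [Fintype k]

theorem IsDensity.traceFirst [Fintype n] {ρ : Op (k × n)} (h : IsDensity ρ) :
    IsDensity (traceFirst ρ) := by
  constructor
  · have e : HMM.traceFirst ρ = ∑ a, ρ.submatrix (fun b => (a, b)) fun b => (a, b) := by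
      ext i j
      simp [HMM.traceFirst, Matrix.sum_apply]
    rw [e]
    exact Matrix.posSemidef_sum _ fun a _ => h.1.submatrix _
  · rw [← h.2]
    simp only [HMM.traceFirst, Matrix.trace, Fintype.sum_prod_type, Matrix.diag, Matrix.of_apply]
    exact Finset.sum_comm

theorem EntryDeriv.traceFirst {ρ : ℝ → Op (k × n)} {X : Op (k × n)} {ω : ℝ}
    (h : EntryDeriv ρ X ω) : EntryDeriv (fun w => traceFirst (ρ w)) (traceFirst X) ω :=
  fun i j => HasDerivAt.fun_sum fun e _ => h (e, i) (e, j)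

theorem trace_one_kronecker_mul [Fintype n] [DecidableEq k] (A : Op n) (X : Op (k × n)) :
    ((1 ⊗ₖ A) * X).trace = (A * traceFirst X).trace := by
  have h : ∀ e i, (((1 : Op k) ⊗ₖ A) * X : Op (k × n)) (e, i) (e, i) =
      ∑ j, A i j * X (e, j) (e, i) := by
    intro e i
    rw [Matrix.mul_apply, Fintype.sum_prod_type, Finset.sum_eq_single e]
    · simp
    · intro b _ hb
      simp [Matrix.one_apply_ne hb.symm]
    · simp
  simp only [Matrix.trace, Matrix.diag, Fintype.sum_prod_type, h]
  rw [Finset.sum_comm]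
  refine Finset.sum_congr rfl fun i _ => ?_
  rw [Matrix.mul_apply, Finset.sum_comm]
  simp only [HMM.traceFirst, Matrix.of_apply, Finset.mul_sum]

theorem FisherBound.traceFirst [Fintype n] {ρ X : Op (k × n)} {c : ℝ} (h : FisherBound ρ X c) :
    FisherBound (traceFirst ρ) (traceFirst X) c := by
  classical
  intro A hA
  have hherm : ((1 : Op k) ⊗ₖ A).IsHermitian := by
    rw [Matrix.IsHermitian, Matrix.conjTranspose_kronecker, Matrix.conjTranspose_one, hA.eq]
  have := h _ hherm
  rwa [← Matrix.mul_kronecker_mul, one_mul, trace_one_kronecker_mul,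
    trace_one_kronecker_mul] at this

end PartialTrace

/-! ### From the variational bound to the eigenvalue formula -/

section Fisher

variable {n : Type} [Fintype n]

/-- The symmetric logarithmic derivative attains the variational bound. -/
theorem qfi_le_of_fisherBound {ρ : ℝ → Op n} {ω c : ℝ} {X : Op n} (hρ : (ρ ω).PosSemidef)
    (hX : EntryDeriv ρ X ω) (hXH : X.IsHermitian) (hc : FisherBound (ρ ω) X c) :
    qfi ρ ω ≤ c := by
  classical
  have hh := hρ.isHermitian
  have hXe : (Matrix.of fun a b => deriv (fun w => ρ w a b) ω) = X := by
    ext a b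
    exact (hX a b).deriv
  have hq : qfi ρ ω = 2 * ∑ i, ∑ j, if 0 < hh.eigenvalues i + hh.eigenvalues j then
      ‖star (hh.eigenvectorBasis i : n → ℂ) ⬝ᵥ (X *ᵥ (hh.eigenvectorBasis j : n → ℂ))‖ ^ 2 /
        (hh.eigenvalues i + hh.eigenvalues j) else 0 := by
    rw [qfi, dif_pos hh, hXe]
  rw [hq]
  set γ := hh.eigenvalues with hγ
  set U : Op n := (hh.eigenvectorUnitary : Op n) with hU
  have hUU : Uᴴ * U = 1 := Matrix.mem_unitaryGroup_iff'.1 hh.eigenvectorUnitary.2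
  have hspec : ρ ω = U * Matrix.diagonal (fun i => (γ i : ℂ)) * Uᴴ := hh.spectral_theorem
  set Y : Op n := Uᴴ * X * U with hY
  have hYH : Y.IsHermitian := by
    simp [Matrix.IsHermitian, hY, hXH.eq, Matrix.conjTranspose_mul, mul_assoc]
  have hYe : ∀ i j, star (hh.eigenvectorBasis i : n → ℂ) ⬝ᵥ
      (X *ᵥ (hh.eigenvectorBasis j : n → ℂ)) = Y i j := by
    intro i j
    rw [hY, mul_assoc, Matrix.mul_apply]
    refine Finset.sum_congr rfl fun a _ => ?_
    simp [hU, Matrix.mulVec, dotProduct, Matrix.mul_apply,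
      Matrix.IsHermitian.eigenvectorUnitary_apply]
  -- The symmetric logarithmic derivative in the eigenbasis of `ρ ω`, set to zero between kernel
  -- vectors.
  set Λ : Op n := Matrix.of fun i j => if 0 < γ i + γ j then 2 * Y i j / ((γ i + γ j : ℝ) : ℂ)
    else 0 with hΛ
  have hΛH : Λ.IsHermitian := by
    ext i j
    simp only [hΛ, Matrix.conjTranspose_apply, Matrix.of_apply, add_comm (γ j)]
    split_ifs
    · rw [← hYH.apply i j]
      simp
    · simp
  have hcond := hc (U * Λ * Uᴴ) (by
    simp [Matrix.IsHermitian, Matrix.conjTranspose_mul, hΛH.eq, mul_assoc])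
  have e1 : (U * Λ * Uᴴ * X).trace = (Λ * Y).trace := by
    rw [hY, mul_assoc, mul_assoc, Matrix.trace_mul_comm]
    simp only [mul_assoc]
  have e2 : (U * Λ * Uᴴ * (U * Λ * Uᴴ) * ρ ω).trace =
      (Λ * Λ * Matrix.diagonal (fun i => (γ i : ℂ))).trace := by
    have : U * Λ * Uᴴ * (U * Λ * Uᴴ) * (U * Matrix.diagonal (fun i => (γ i : ℂ)) * Uᴴ) =
        U * (Λ * ((Uᴴ * U) * (Λ * ((Uᴴ * U) * (Matrix.diagonal (fun i => (γ i : ℂ)) * Uᴴ))))) := by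
      simp only [mul_assoc]
    rw [hspec, this, hUU, one_mul, one_mul, Matrix.trace_mul_comm]
    simp only [mul_assoc, hUU, mul_one]
  set q : n → n → ℝ := fun i j =>
    if 0 < γ i + γ j then ‖Y i j‖ ^ 2 / (γ i + γ j) else 0 with hqdef
  have t1 : (Λ * Y).trace.re = ∑ i, ∑ j, 2 * q i j := by
    simp only [Matrix.trace, Matrix.diag, Matrix.mul_apply, Complex.re_sum]
    refine Finset.sum_congr rfl fun i _ => Finset.sum_congr rfl fun j _ => ?_
    simp only [hΛ, hqdef, Matrix.of_apply]
    split_ifs with hpos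
    · rw [← hYH.apply j i, div_mul_eq_mul_div, Complex.div_ofReal_re, mul_assoc,
        Complex.star_def, Complex.mul_conj, Complex.normSq_eq_norm_sq,
        ← Complex.ofReal_ofNat, Complex.re_ofReal_mul, Complex.ofReal_re, mul_div_assoc]
    · simp
  have t2 : (Λ * Λ * Matrix.diagonal (fun i => (γ i : ℂ))).trace.re =
      ∑ i, ∑ j, ‖Λ i j‖ ^ 2 * γ i := by
    simp only [Matrix.trace, Matrix.diag, Complex.re_sum]
    refine Finset.sum_congr rfl fun i _ => ?_
    rw [Matrix.mul_diagonal, Matrix.mul_apply, Finset.sum_mul, Complex.re_sum]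
    refine Finset.sum_congr rfl fun j _ => ?_
    rw [← hΛH.apply j i, Complex.star_def, Complex.mul_conj, Complex.normSq_eq_norm_sq,
      ← Complex.ofReal_mul, Complex.ofReal_re]
  -- Symmetrizing in `i` and `j` replaces `γ i` by `(γ i + γ j) / 2`, which cancels one denominator.
  have t3 : ∑ i, ∑ j, ‖Λ i j‖ ^ 2 * γ i = ∑ i, ∑ j, 2 * q i j := by
    have hsymm : ∑ i, ∑ j, ‖Λ i j‖ ^ 2 * γ i = ∑ i, ∑ j, ‖Λ i j‖ ^ 2 * γ j := by
      rw [Finset.sum_comm]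
      refine Finset.sum_congr rfl fun i _ => Finset.sum_congr rfl fun j _ => ?_
      rw [← hΛH.apply i j, norm_star]
    have hadd : ∑ i, ∑ j, ‖Λ i j‖ ^ 2 * γ i + ∑ i, ∑ j, ‖Λ i j‖ ^ 2 * γ j =
        ∑ i, ∑ j, 2 * q i j + ∑ i, ∑ j, 2 * q i j := by
      simp only [← Finset.sum_add_distrib]
      refine Finset.sum_congr rfl fun i _ => Finset.sum_congr rfl fun j _ => ?_
      simp only [hΛ, hqdef, Matrix.of_apply]
      split_ifs with hpos
      · rw [norm_div, norm_mul, Complex.norm_real, Real.norm_of_nonneg hpos.le,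
          Complex.norm_ofNat]
        field_simp
        ring
      · simp
    linarith
  rw [e1, e2, t1, t2, t3] at hcond
  simp only [hYe]
  have hfinal : ∑ i, ∑ j, 2 * q i j = 2 * ∑ i, ∑ j, q i j := by
    simp only [Finset.mul_sum]
  linarith

end Fisher

/-! ### Cauchy-Schwarz estimates in a state -/

section Positivity

variable {n : Type} [Fintype n]

theorem re_trace_mul_conjTranspose_mul_self_nonneg {ρ : Op n} (hρ : ρ.PosSemidef) (X : Op n) :
    0 ≤ (ρ * (Xᴴ * X)).trace.re := by
  have h := (hρ.mul_mul_conjTranspose_same X).trace_nonneg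
  have e : (X * ρ * Xᴴ).trace = (ρ * (Xᴴ * X)).trace := by
    rw [Matrix.trace_mul_comm, ← mul_assoc, Matrix.trace_mul_comm]
  rw [e] at h
  exact (Complex.le_def.1 h).1

open scoped MatrixOrder Matrix.Norms.L2Operator in
theorem re_trace_mul_nonneg {ρ P : Op n} (hρ : ρ.PosSemidef) (hP : P.PosSemidef) :
    0 ≤ (ρ * P).trace.re := by
  classical
  obtain ⟨X, rfl⟩ := CStarAlgebra.nonneg_iff_eq_star_mul_self.1 hP.nonneg
  exact re_trace_mul_conjTranspose_mul_self_nonneg hρ X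

theorem dissipation_nonneg {r : ℕ} (L : Fin r → Op n) {ρ : Op n} (hρ : ρ.PosSemidef) (A : Op n) :
    0 ≤ dissipation L ρ A :=
  Finset.sum_nonneg fun _ _ => re_trace_mul_conjTranspose_mul_self_nonneg hρ _

theorem le_dissipation {r : ℕ} (L : Fin r → Op n) {ρ : Op n} (hρ : ρ.PosSemidef) (A : Op n)
    (k : Fin r) : (ρ * ((L k * A - A * L k)ᴴ * (L k * A - A * L k))).trace.re ≤
      dissipation L ρ A :=
  Finset.single_le_sum (f := fun k =>
    (ρ * ((L k * A - A * L k)ᴴ * (L k * A - A * L k))).trace.re)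
    (fun _ _ => re_trace_mul_conjTranspose_mul_self_nonneg hρ _) (Finset.mem_univ k)

theorem trace_mul_conjTranspose_mul_swap {ρ : Op n} (hρ : ρ.IsHermitian) (X Y : Op n) :
    (ρ * (Yᴴ * X)).trace = star (ρ * (Xᴴ * Y)).trace := by
  rw [← Matrix.trace_conjTranspose, Matrix.conjTranspose_mul, Matrix.conjTranspose_mul, hρ.eq,
    Matrix.conjTranspose_conjTranspose, Matrix.trace_mul_comm]

/-- Expand the nonnegative expectation of `(z̄X - Y)† (z̄X - Y)`. -/
theorem two_mul_re_trace_le {ρ : Op n} (hρ : ρ.PosSemidef) (X Y : Op n) (z : ℂ) :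
    2 * (z * (ρ * (Xᴴ * Y)).trace).re ≤
      (ρ * (Xᴴ * X)).trace.re * ‖z‖ ^ 2 + (ρ * (Yᴴ * Y)).trace.re := by
  have h := re_trace_mul_conjTranspose_mul_self_nonneg hρ (star z • X - Y)
  have e : (ρ * ((star z • X - Y)ᴴ * (star z • X - Y))).trace =
      ((‖z‖ ^ 2 : ℝ) : ℂ) * (ρ * (Xᴴ * X)).trace - z * (ρ * (Xᴴ * Y)).trace
        - star (z * (ρ * (Xᴴ * Y)).trace) + (ρ * (Yᴴ * Y)).trace := by
    have hz : z * star z = ((‖z‖ ^ 2 : ℝ) : ℂ) := by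
      rw [Complex.star_def, Complex.mul_conj, Complex.normSq_eq_norm_sq]
    rw [star_mul', ← trace_mul_conjTranspose_mul_swap hρ.isHermitian, ← hz]
    simp only [Matrix.conjTranspose_sub, Matrix.conjTranspose_smul, star_star, sub_mul, mul_sub,
      smul_mul_assoc, mul_smul_comm, Matrix.trace_sub, Matrix.trace_smul, smul_eq_mul]
    ring
  rw [e] at h
  simp only [Complex.add_re, Complex.sub_re, Complex.re_ofReal_mul, Complex.star_def,
    Complex.conj_re] at h
  linarith

open scoped MatrixOrder Matrix.Norms.L2Operator in
theorem exists_posSemidef_smul_one_sub [DecidableEq n] {Q : Op n} (hQ : Q.IsHermitian) :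
    ∃ c : ℝ, 0 ≤ c ∧ ((c : ℂ) • (1 : Op n) - Q).PosSemidef := by
  refine ⟨‖Q‖, norm_nonneg Q, ?_⟩
  have h : Q ≤ algebraMap ℝ (Op n) ‖Q‖ := IsSelfAdjoint.le_algebraMap_norm_self hQ
  rw [Matrix.le_iff] at h
  have e : algebraMap ℝ (Op n) ‖Q‖ = ((‖Q‖ : ℝ) : ℂ) • (1 : Op n) := by
    rw [Algebra.algebraMap_eq_smul_one]
    rfl
  rwa [e] at h

end Positivity

/-! ### Extension to the auxiliary system -/

section Lift

variable {dE dP : ℕ} (dA : ℕ) (X Y : Op (Fin dE × Fin dP))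

theorem lift_mul : lift dA (X * Y) = lift dA X * lift dA Y := by
  rw [lift, lift, lift, Matrix.submatrix_mul_equiv, ← Matrix.mul_kronecker_mul, one_mul]

theorem lift_add : lift dA (X + Y) = lift dA X + lift dA Y := by
  rw [lift, Matrix.add_kronecker]
  rfl

theorem lift_smul (z : ℂ) : lift dA (z • X) = z • lift dA X := by
  rw [lift, Matrix.smul_kronecker]
  rfl

theorem lift_one : lift dA (1 : Op (Fin dE × Fin dP)) = 1 := by
  rw [lift, Matrix.one_kronecker_one, Matrix.submatrix_one_equiv]

theorem lift_conjTranspose : lift dA Xᴴ = (lift dA X)ᴴ := by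
  rw [lift, lift, Matrix.conjTranspose_submatrix, Matrix.conjTranspose_kronecker,
    Matrix.conjTranspose_one]

variable {X}

theorem isHermitian_lift (hX : X.IsHermitian) : (lift dA X).IsHermitian := by
  rw [Matrix.IsHermitian, ← lift_conjTranspose, hX.eq]

theorem posSemidef_lift (hX : X.PosSemidef) : (lift dA X).PosSemidef :=
  (hX.kronecker Matrix.PosSemidef.one).submatrix _

/-- The operator inequality `X†X ≤ c` is preserved by tensoring with `1_A`. This is the source of
uniformity in the auxiliary dimension. -/
theorem exists_trace_lift_le (X : Op (Fin dE × Fin dP)) : ∃ c : ℝ, 0 ≤ c ∧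
    ∀ (dA : ℕ) (ρ : Op (EPA dE dP dA)), IsDensity ρ →
      (ρ * ((lift dA X)ᴴ * lift dA X)).trace.re ≤ c := by
  obtain ⟨c, hc, hP⟩ := exists_posSemidef_smul_one_sub (Matrix.isHermitian_conjTranspose_mul_self X)
  refine ⟨c, hc, fun dA ρ hρ => ?_⟩
  have h := re_trace_mul_nonneg hρ.1 (posSemidef_lift dA hP)
  rw [sub_eq_add_neg, ← neg_one_smul ℂ (Xᴴ * X), lift_add, lift_smul, lift_smul, lift_one,
    lift_mul, lift_conjTranspose, mul_add, mul_smul_comm, mul_smul_comm, mul_one,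
    Matrix.trace_add, Matrix.trace_smul, Matrix.trace_smul, hρ.2] at h
  simp only [smul_eq_mul, mul_one, neg_mul, one_mul, Complex.add_re, Complex.neg_re,
    Complex.ofReal_re] at h
  linarith

end Lift

/-! ### Commutators with the Lindblad span are controlled by dissipation -/

section DissipativeBound

variable {dE dP r : ℕ}

/-- A functional of state and observable which is bounded by the square root of the dissipation,
uniformly in the auxiliary dimension. -/
def DissipativelyBounded (L : Fin r → Op (Fin dE × Fin dP))
    (f : ∀ dA : ℕ, Op (EPA dE dP dA) → Op (EPA dE dP dA) → ℂ) : Prop :=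
  ∃ K : ℝ, ∀ (dA : ℕ) (ρ A : Op (EPA dE dP dA)), IsDensity ρ → A.IsHermitian → ∀ z : ℂ,
    2 * (z * f dA ρ A).re ≤ K * ‖z‖ ^ 2 + dissipation (fun k => lift dA (L k)) ρ A

variable {L : Fin r → Op (Fin dE × Fin dP)}
  {f g : ∀ dA : ℕ, Op (EPA dE dP dA) → Op (EPA dE dP dA) → ℂ}

/-- Both bounds are used at `2z` and averaged, so that the dissipation enters only once; this is
possible because the bounds hold for every `z`. -/
theorem DissipativelyBounded.add (hf : DissipativelyBounded L f) (hg : DissipativelyBounded L g) :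
    DissipativelyBounded L fun dA ρ A => f dA ρ A + g dA ρ A := by
  obtain ⟨K, hK⟩ := hf
  obtain ⟨K', hK'⟩ := hg
  refine ⟨2 * (K + K'), fun dA ρ A hρ hA z => ?_⟩
  have h1 := hK dA ρ A hρ hA (2 * z)
  have h2 := hK' dA ρ A hρ hA (2 * z)
  rw [norm_mul, Complex.norm_ofNat, mul_assoc, ← Complex.ofReal_ofNat, Complex.re_ofReal_mul]
    at h1 h2
  rw [mul_add, Complex.add_re]
  nlinarith

theorem DissipativelyBounded.smul (hf : DissipativelyBounded L f) (c : ℂ) :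
    DissipativelyBounded L fun dA ρ A => c * f dA ρ A := by
  obtain ⟨K, hK⟩ := hf
  refine ⟨K * ‖c‖ ^ 2, fun dA ρ A hρ hA z => ?_⟩
  have h := hK dA ρ A hρ hA (z * c)
  rw [norm_mul, mul_pow, mul_assoc z] at h
  linarith

theorem dissipativelyBounded_zero : DissipativelyBounded L fun _ _ _ => 0 :=
  ⟨0, fun dA ρ A hρ _ z => by simpa using dissipation_nonneg _ hρ.1 A⟩

theorem dissipativelyBounded_left (X : Op (Fin dE × Fin dP)) (k : Fin r) :
    DissipativelyBounded L fun dA ρ A => (ρ * ((lift dA X)ᴴ *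
      (lift dA (L k) * A - A * lift dA (L k)))).trace := by
  obtain ⟨c, -, hc⟩ := exists_trace_lift_le X
  refine ⟨c, fun dA ρ A hρ _ z => ?_⟩
  refine (two_mul_re_trace_le hρ.1 _ _ z).trans (add_le_add ?_
    (le_dissipation (fun k => lift dA (L k)) hρ.1 A k))
  exact mul_le_mul_of_nonneg_right (hc dA ρ hρ) (by positivity)

/-- This functional is the complex conjugate of the left one, so the left bound at `star z` applies.
-/
theorem dissipativelyBounded_right (X : Op (Fin dE × Fin dP)) (k : Fin r) :
    DissipativelyBounded L fun dA ρ A => (ρ *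
      ((lift dA (L k) * A - A * lift dA (L k))ᴴ * lift dA X)).trace := by
  obtain ⟨K, hK⟩ := dissipativelyBounded_left (L := L) X k
  refine ⟨K, fun dA ρ A hρ hA z => ?_⟩
  have h := hK dA ρ A hρ hA (star z)
  have e : star (star z * (ρ * ((lift dA X)ᴴ *
      (lift dA (L k) * A - A * lift dA (L k)))).trace) = z * (ρ *
      ((lift dA (L k) * A - A * lift dA (L k))ᴴ * lift dA X)).trace := by
    rw [star_mul', star_star, ← trace_mul_conjTranspose_mul_swap hρ.1.isHermitian]
  rw [norm_star, ← Complex.conj_re, ← Complex.star_def, e] at h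
  exact h

/-- The commutator with an element of the Lindblad span is controlled by the dissipation. -/
theorem dissipativelyBounded_of_mem_lindbladSpan (M : Model dE dP r)
    {S : Op (Fin dE × Fin dP)} (hS : S ∈ M.lindbladSpan) :
    DissipativelyBounded M.L fun dA ρ A => (ρ * (lift dA S * A - A * lift dA S)).trace := by
  have hcongr : ∀ {f g : ∀ dA : ℕ, Op (EPA dE dP dA) → Op (EPA dE dP dA) → ℂ},
      DissipativelyBounded M.L f → (∀ dA ρ A, A.IsHermitian → g dA ρ A = f dA ρ A) →
      DissipativelyBounded M.L g := by
    rintro f g ⟨K, hK⟩ h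
    exact ⟨K, fun dA ρ A hρ hA z => by rw [h dA ρ A hA]; exact hK dA ρ A hρ hA z⟩
  induction hS using Submodule.span_induction with
  | mem S hS =>
    rcases hS with ((rfl | ⟨k, rfl⟩) | ⟨k, rfl⟩) | ⟨⟨k, j⟩, rfl⟩
    · exact hcongr dissipativelyBounded_zero fun dA ρ A _ => by simp [lift_one]
    · exact hcongr (dissipativelyBounded_left 1 k) fun dA ρ A _ => by simp [lift_one]
    · refine hcongr ((dissipativelyBounded_right 1 k).smul (-1)) fun dA ρ A hA => ?_
      simp only [lift_one, lift_conjTranspose, Matrix.conjTranspose_sub,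
        Matrix.conjTranspose_mul, hA.eq, mul_one, mul_sub, Matrix.trace_sub]
      ring
    -- Leibniz rule for Hermitian `A`: `[Lₖ† Lⱼ, A] = Lₖ† [Lⱼ, A] - [Lₖ, A]† Lⱼ`.
    · refine hcongr ((dissipativelyBounded_left (M.L k) j).add
        ((dissipativelyBounded_right (M.L j) k).smul (-1))) fun dA ρ A hA => ?_
      simp only [lift_mul, lift_conjTranspose, Matrix.conjTranspose_sub,
        Matrix.conjTranspose_mul, hA.eq, mul_sub, sub_mul, Matrix.trace_sub, mul_assoc]
      ring
  | zero =>
    refine hcongr dissipativelyBounded_zero fun dA ρ A _ => ?_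
    rw [← zero_smul ℂ (0 : Op (Fin dE × Fin dP)), lift_smul]
    simp
  | add S S' _ _ h h' =>
    refine hcongr (h.add h') fun dA ρ A _ => ?_
    simp only [lift_add, add_mul, mul_add, mul_sub, Matrix.trace_add, Matrix.trace_sub]
    ring
  | smul c S _ h =>
    refine hcongr (h.smul c) fun dA ρ A _ => ?_
    simp only [lift_smul, smul_mul_assoc, mul_smul_comm, mul_sub, Matrix.trace_sub,
      Matrix.trace_smul, smul_eq_mul]

theorem exists_signalBound (M : Model dE dP r) (h : M.signal ∈ M.lindbladSpan) :
    ∃ K : ℝ, ∀ dA, SignalBound (lift dA M.signal) (fun k => lift dA (M.L k)) K := by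
  obtain ⟨K, hK⟩ := dissipativelyBounded_of_mem_lindbladSpan M h
  exact ⟨K, fun dA ρ A hρ hA => by simpa using hK dA ρ A hρ hA Complex.I⟩

end DissipativeBound

/-! ### Induction over the stages of a strategy -/

section Strategies

variable {dE dP dA r : ℕ} (M : Model dE dP r)

theorem Model.signal_isHermitian : M.signal.IsHermitian := by
  rw [Matrix.IsHermitian, Model.signal, Matrix.conjTranspose_add, Matrix.conjTranspose_kronecker,
    Matrix.conjTranspose_kronecker, M.G_herm.eq, M.HE_herm.eq, Matrix.conjTranspose_one,
    Matrix.conjTranspose_one]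

theorem Model.generator_eq (ω : ℝ) : M.generator dA ω = lindbladian
    (lift dA M.HEP + (ω : ℂ) • lift dA M.signal) (fun k => lift dA (M.L k)) := by
  rw [Model.generator, lift_add, lift_smul]

theorem IsDensity.stage {ρ : Op (EPA dE dP dA)} (hρ : IsDensity ρ) (s : Stage dP dA) (ω : ℝ) :
    IsDensity (ampliate s.control (semigroup (M.generator dA ω) s.duration ρ)) := by
  rw [M.generator_eq]
  have h := hρ.semigroup_lindbladian (isHermitian_add_real_smul (isHermitian_lift dA M.HEP_herm)
    (isHermitian_lift dA M.signal_isHermitian) ω) (fun k => lift dA (M.L k)) s.duration_nonneg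
  exact ⟨s.control_cptp.completely_positive _ _ h.1,
    (s.control_cptp.trace_ampliate _).trans h.2⟩

theorem FisherBound.stages {K : ℝ}
    (hK : SignalBound (lift dA M.signal) (fun k => lift dA (M.L k)) K) (ω : ℝ)
    (l : List (Stage dP dA)) : ∀ (ρ : ℝ → Op (EPA dE dP dA)) (X : Op (EPA dE dP dA)) (c : ℝ),
    (∀ w, IsDensity (ρ w)) → EntryDeriv ρ X ω → FisherBound (ρ ω) X c →
    (∀ w, IsDensity (l.foldl (fun ρ s => ampliate s.control
      (semigroup (M.generator dA w) s.duration ρ)) (ρ w))) ∧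
    ∃ Y, EntryDeriv (fun w => l.foldl (fun ρ s => ampliate s.control
      (semigroup (M.generator dA w) s.duration ρ)) (ρ w)) Y ω ∧
      FisherBound (l.foldl (fun ρ s => ampliate s.control
        (semigroup (M.generator dA ω) s.duration ρ)) (ρ ω)) Y
        (c + K * (l.map Stage.duration).sum) := by
  induction l with
  | nil =>
    intro ρ X c hρ hX hc
    exact ⟨hρ, X, hX, by simpa using hc⟩
  | cons s l ih =>
    intro ρ X c hρ hX hc
    obtain ⟨Y, hY, hYc⟩ := hc.free_evolution (isHermitian_lift dA M.HEP_herm)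
      (isHermitian_lift dA M.signal_isHermitian) hK (hρ ω) s.duration_nonneg hX
    simp only [← M.generator_eq] at hY hYc
    have hpos : (semigroup (M.generator dA ω) s.duration (ρ ω)).PosSemidef := by
      rw [M.generator_eq]
      exact ((hρ ω).semigroup_lindbladian (isHermitian_add_real_smul
        (isHermitian_lift dA M.HEP_herm) (isHermitian_lift dA M.signal_isHermitian) ω) _
        s.duration_nonneg).1
    have h := ih (fun w => ampliate s.control (semigroup (M.generator dA w) s.duration (ρ w)))
      (ampliateLinear s.control Y) (c + K * s.duration)
      (fun w => (hρ w).stage M s w) (hY.map (ampliateLinear s.control))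
      (hYc.map s.control_cptp.isTwoPositive_ampliate s.control_cptp.trace_ampliate hpos)
    simpa [List.foldl_cons, mul_add, add_assoc] using h

theorem Strategy.output_fisherBound {K : ℝ}
    (hK : SignalBound (lift dA M.signal) (fun k => lift dA (M.L k)) K)
    (S : Strategy dE dP dA) (ω : ℝ) :
    (∀ w, IsDensity (S.output M w)) ∧ ∃ Y, EntryDeriv (S.output M) Y ω ∧
      FisherBound (S.output M ω) Y (K * S.totalTime) := by
  -- The initial state carries no information about `ω`, so the induction starts from derivative `0`
  -- and bound `0`.
  have h0 : FisherBound S.init 0 0 := by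
    intro A hA
    have h := re_trace_mul_conjTranspose_mul_self_nonneg S.init_density.1 A
    rw [hA.eq, Matrix.trace_mul_comm] at h
    simpa using h
  obtain ⟨h1, Y, hY, hc⟩ := FisherBound.stages M hK ω S.stages (fun _ => S.init) 0 0
    (fun _ => S.init_density) (entryDeriv_const _ _) h0
  rw [zero_add] at hc
  exact ⟨fun w => (h1 w).traceFirst, traceFirst Y, hY.traceFirst, hc.traceFirst⟩

theorem EntryDeriv.isHermitian {n : Type} {ρ : ℝ → Op n} {X : Op n} {ω : ℝ}
    (h : EntryDeriv ρ X ω) (hρ : ∀ w, (ρ w).IsHermitian) : X.IsHermitian := by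
  ext i j
  have h' := h.conjTranspose i j
  simp only [(hρ _).eq] at h'
  exact h'.unique (h i j)

end Strategies

/-! ### Environment blocks and the extended span -/

section ExtendedSpan

variable {dE dP r : ℕ}

theorem block_add (u v : EuclideanSpace ℂ (Fin dE)) (A B : Op (Fin dE × Fin dP)) :
    block u v (A + B) = block u v A + block u v B := by
  ext p q
  simp only [block, Matrix.of_apply, Matrix.add_apply, mul_add, add_mul, Finset.sum_add_distrib]

theorem block_smul (u v : EuclideanSpace ℂ (Fin dE)) (c : ℂ) (A : Op (Fin dE × Fin dP)) :
    block u v (c • A) = c • block u v A := by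
  ext p q
  simp only [block, Matrix.of_apply, Matrix.smul_apply, smul_eq_mul, Finset.mul_sum]
  exact Finset.sum_congr rfl fun a _ => Finset.sum_congr rfl fun b _ => by ring

theorem block_kronecker (u v : EuclideanSpace ℂ (Fin dE)) (A : Op (Fin dE)) (B : Op (Fin dP)) :
    block u v (A ⊗ₖ B) = (∑ a, ∑ b, star (u a) * A a b * v b) • B := by
  ext p q
  simp only [block, Matrix.of_apply, Matrix.smul_apply, smul_eq_mul, Finset.sum_mul,
    Matrix.kroneckerMap_apply]
  exact Finset.sum_congr rfl fun a _ => Finset.sum_congr rfl fun b _ => by ring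

/-- The isometry `x ↦ u ⊗ x` for an environment vector `u`. -/
def embed {dE dP : ℕ} (u : EuclideanSpace ℂ (Fin dE)) : Matrix (Fin dE × Fin dP) (Fin dP) ℂ :=
  Matrix.of fun x q => if x.2 = q then u x.1 else 0

theorem block_eq_embed (u v : EuclideanSpace ℂ (Fin dE)) (A : Op (Fin dE × Fin dP)) :
    block u v A = (embed (dP := dP) u)ᴴ * A * embed (dP := dP) v := by
  ext p q
  simp only [block, embed, Matrix.mul_apply, Fintype.sum_prod_type, Matrix.conjTranspose_apply,
    Matrix.of_apply, mul_ite, mul_zero, Finset.sum_ite_eq', Finset.mem_univ, if_true,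
    Finset.sum_mul, apply_ite star, star_zero, ite_mul, zero_mul]
  exact Finset.sum_comm

theorem sum_embed_mul_conjTranspose
    (φ : OrthonormalBasis (Fin dE) ℂ (EuclideanSpace ℂ (Fin dE))) :
    ∑ n, embed (dP := dP) (φ n) * (embed (dP := dP) (φ n))ᴴ = 1 := by
  have hφ : ∀ a b, ∑ n, φ n a * star (φ n b) = if a = b then 1 else 0 := by
    intro a b
    have h := φ.sum_inner_mul_inner (EuclideanSpace.single a 1) (EuclideanSpace.single b 1)
    simpa [EuclideanSpace.inner_single_left, EuclideanSpace.inner_single_right, Pi.single_apply,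
      eq_comm] using h
  ext ⟨a, p⟩ ⟨b, q⟩
  rw [Matrix.sum_apply, Matrix.one_apply]
  by_cases hpq : p = q
  · simpa [embed, Matrix.mul_apply, hpq] using hφ a b
  · simp [embed, Matrix.mul_apply, hpq, apply_ite]

/-- Insert the resolution of the identity `∑ₙ |φₙ⟩⟨φₙ| ⊗ 1` between the factors. -/
theorem block_mul (φ : OrthonormalBasis (Fin dE) ℂ (EuclideanSpace ℂ (Fin dE)))
    (u v : EuclideanSpace ℂ (Fin dE)) (A B : Op (Fin dE × Fin dP)) :
    block u v (A * B) = ∑ n, block u (φ n) A * block (φ n) v B := by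
  have h : A * B = A * (∑ n, embed (dP := dP) (φ n) * (embed (dP := dP) (φ n))ᴴ) * B := by
    rw [sum_embed_mul_conjTranspose, mul_one]
  rw [block_eq_embed, h]
  simp only [block_eq_embed, Matrix.mul_sum, Matrix.sum_mul, Matrix.mul_assoc]

/-- All blocks of elements of the Lindblad span lie in the extended span. -/
theorem block_mem_extendedSpan (M : Model dE dP r)
    (φ : OrthonormalBasis (Fin dE) ℂ (EuclideanSpace ℂ (Fin dE))) {X : Op (Fin dE × Fin dP)}
    (hX : X ∈ M.lindbladSpan) (i m : Fin dE) : block (φ i) (φ m) X ∈ M.extendedSpan φ := by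
  induction hX using Submodule.span_induction with
  | mem X hX =>
    rcases hX with ((rfl | ⟨k, rfl⟩) | ⟨k, rfl⟩) | ⟨⟨k, j⟩, rfl⟩
    · rw [← Matrix.one_kronecker_one, block_kronecker]
      exact Submodule.smul_mem _ _ (Submodule.subset_span (Or.inl rfl))
    · exact Submodule.subset_span (Or.inr (Or.inr (Or.inl ⟨i, m, k, rfl⟩)))
    · exact Submodule.subset_span (Or.inr (Or.inr (Or.inr (Or.inl ⟨i, m, k, rfl⟩))))
    · simp only [block_mul φ]
      exact Submodule.sum_mem _ fun n _ => Submodule.subset_span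
        (Or.inr (Or.inr (Or.inr (Or.inr ⟨i, n, n, m, k, j, rfl⟩))))
  | zero =>
    rw [← zero_smul ℂ (0 : Op (Fin dE × Fin dP)), block_smul, zero_smul]
    exact Submodule.zero_mem _
  | add X Y _ _ hX hY => rw [block_add]; exact Submodule.add_mem _ hX hY
  | smul c X _ hX => rw [block_smul]; exact Submodule.smul_mem _ c hX

/-- A diagonal block of the signal is `G + ⟨φᵢ|H_E|φᵢ⟩ 1`, and `1` lies in the span. Positive
environment dimension provides the index `i`. -/
theorem Model.G_mem_extendedSpan (M : Model dE dP r) (hE : 0 < dE)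
    (h : M.signal ∈ M.lindbladSpan)
    (φ : OrthonormalBasis (Fin dE) ℂ (EuclideanSpace ℂ (Fin dE))) :
    M.G ∈ M.extendedSpan φ := by
  set i : Fin dE := ⟨0, hE⟩
  have hmem := block_mem_extendedSpan M φ h i i
  have hunit : ∑ a, ∑ b, star (φ i a) * (1 : Op (Fin dE)) a b * φ i b = 1 := by
    have h1 : inner ℂ (φ i) (φ i) = (1 : ℂ) := by
      rw [inner_self_eq_norm_sq_to_K, φ.orthonormal.1 i]
      simp
    rw [PiLp.inner_apply] at h1
    rw [← h1]
    refine Finset.sum_congr rfl fun a _ => ?_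
    simp [Matrix.one_apply, mul_comm, Complex.mul_conj, Complex.normSq_eq_norm_sq]
  rw [Model.signal, block_add, block_kronecker, block_kronecker, hunit, one_smul] at hmem
  have hone : (1 : Op (Fin dP)) ∈ M.extendedSpan φ := Submodule.subset_span (Or.inl rfl)
  exact (Submodule.add_mem_iff_left _ (Submodule.smul_mem _ _ hone)).1 hmem

end ExtendedSpan

end HMM

end

theorem theorem4 {dE dP r : ℕ} (hE : 0 < dE) (M : HMM.Model dE dP r)
    (h : M.signal ∈ M.lindbladSpan) :
    (∃ C : ℝ, ∀ (dA : ℕ) (S : HMM.Strategy dE dP dA) (ω : ℝ),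
      HMM.IsDensity (S.output M ω) ∧
      (∀ a b, DifferentiableAt ℝ (fun w => S.output M w a b) ω) ∧
      HMM.qfi (S.output M) ω ≤ C * S.totalTime) ∧
    (∀ φ : OrthonormalBasis (Fin dE) ℂ (EuclideanSpace ℂ (Fin dE)),
      M.G ∈ M.extendedSpan φ) := by
  obtain ⟨K, hK⟩ := HMM.exists_signalBound M h
  refine ⟨⟨K, fun dA S ω => ?_⟩, fun φ => M.G_mem_extendedSpan hE h φ⟩
  obtain ⟨hρ, Y, hY, hc⟩ := S.output_fisherBound M (hK dA) ω
  exact ⟨hρ ω, fun a b => (hY a b).differentiableAt,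
    HMM.qfi_le_of_fisherBound (hρ ω).1 hY (hY.isHermitian fun w => (hρ w).1.isHermitian) hc⟩
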